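/- **Theorem (cumulative regret of MLE-LOOP).** *Setting.* Let $\mathcal M=(\mathcal S,\mathcal A,r,\mathbb P)$ be an average-reward MDP with Borel state space $\mathcal S$, finite action set $\mathcal A$, measurable reward $r:\mathcal S\times\mathcal A\to[-1,1]$ and transition kernel $\mathbb P$. Assume the Bellman optimality equation: there are a bounded measurable $Q^*$ and $J^*\in[-1,1]$ with $$J^*+Q^*(s,a)=r(s,a)+\mathbb E_{s'\sim\mathbb P(\cdot|s,a)}[V^*(s')],\qquad V^*(s)=\max_aQ^*(s,a).$$ Write $\mathrm{sp}(V)=\sup_{s,s'}|V(s)-V(s')|$. Let $\mathcal H$ be a model-based class: each $f\in\mathcal H$ consists of a transition law with density $\mathbb P_f(s'|s,a)$ (with respect to a reference measure on $\mathcal S$, possibly depending on $(s,a)$, shared by all $f$) and a reward $r_f$ with values in $[-1,1]$, together with $Q_f,J_f$ (and $V_f=\max_aQ_f(\cdot,a)$) solving the Bellman optimality equation of the model $(\mathbb P_f,r_f)$. Assume realizability: the hypothesis $f^*$ of the true model ($\mathbb P_{f^*}=\mathbb P$, $r_{f^*}=r$, $Q_{f^*}=Q^*$, $J_{f^*}=J^*$)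 belongs to $\mathcal H$; and assume $\mathrm{sp}(V_f)\le\mathrm{sp}(V^*)$ for all $f\in\mathcal H$. *Algorithm.* Let $\mathcal D_t=\{(s_i,a_i,s_{i+1}):i\le t\}$ and $\mathcal L_{\mathcal D}(g)=-\sum_{(s,a,s')\in\mathcal D}\log\mathbb P_g(s'|s,a)$. MLE-LOOP with parameter $\beta$ (and $\mathcal G=\mathcal H$) starts at a given $s_1$ and at each step $t=1,\dots,T$: lets $g_t\in\mathcal H$ be a minimizer of $\mathcal L_{\mathcal D_{t-1}}$ over $\mathcal H$; if $t=1$ or $\Upsilon_{t-1}\ge3\sqrt{\beta t}$, chooses $f_t$ maximizing $J_f$ over $\{f\in\mathcal H:\mathcal L_{\mathcal D_{t-1}}(f)-\inf_{g\in\mathcal H}\mathcal L_{\mathcal D_{t-1}}(g)\le\beta\}$, and otherwise keeps $f_t=f_{t-1}$; plays $a_t\in\arg\max_aQ_{f_t}(s_t,a)$; observes $s_{t+1}\sim\mathbb P(\cdot|s_t,a_t)$; and sets $\Upsilon_t=\sum_{i=1}^t\mathrm{TV}(\mathbb P_{f_t}(\cdot|s_i,a_i),\mathbb P_{g_t}(\cdot|s_i,a_i))$.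 Ties are broken arbitrarily. The regret is $\mathrm{Reg}(T)=\sum_{t=1}^T(J^*-r(s_t,a_t))$. *Complexity.* For $g\in\mathcal H$ let $\ell_g(s,a)=\mathbb E_{s'\sim\mathbb P(\cdot|s,a)}\big[\tfrac12|\mathbb P_g(s'|s,a)/\mathbb P_{f^*}(s'|s,a)-1|\big]$ (the expected MLE discrepancy), and let $\mathcal E(f)(s,a)=Q_f(s,a)-r(s,a)-\mathbb E_{s'\sim\mathbb P(\cdot|s,a)}[V_f(s')]+J_f$. Fix a constant $C_1>0$ and a polynomial $p$ that is nonnegative on $[0,\infty)$. The MLE-AGEC coefficients with parameter $\epsilon=1/\sqrt T$ are the smallest reals $d_{\rm G}\ge1$ and $\kappa_{\rm G}\ge1$ such that, for all $f_1,\dots,f_T\in\mathcal H$ and all $(s_1,a_1),\dots,(s_T,a_T)\in\mathcal S\times\mathcal A$, 1. $\sum_{t=1}^T\mathcal E(f_t)(s_t,a_t)\le d_{\rm G}\,\mathrm{sp}(V^*)\sum_{t=1}^T\ell_{f_t}(s_t,a_t)$; 2. for every $b>0$, if $\sum_{i=1}^{t-1}\ell_{f_t}(s_i,a_i)\le\sqrt{bt}$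 for all $t\le T$, then $\sum_{t=1}^T\ell_{f_t}(s_t,a_t)\le p(\log T)\sqrt{\kappa_{\rm G}bT}+C_1\mathrm{sp}(V^*)^2\min\{\kappa_{\rm G},T\}+2T\epsilon^2$. They are assumed to exist. The bracketing number $\mathcal B_{\mathcal H}(\rho)$, assumed finite at $\rho=1/T$, is the least cardinality of a set $U$ of measurable functions $u(s'|s,a)\ge0$ such that every $f\in\mathcal H$ has some $u\in U$ with $u\ge\mathbb P_f$ pointwise and $\|u(\cdot|s,a)-\mathbb P_f(\cdot|s,a)\|_1\le\rho$ for all $(s,a)$. *Claim.* There is an absolute constant $c>0$, and for every $C_1>0$ a constant $C>0$ depending only on $C_1$, such that in the above setting, for every $p$, every $\delta\in(0,1)$ and every horizon $T\ge1$, with probability at least $1-4\delta$ the regret of MLE-LOOP run with $$\beta=c\,\max\{\mathrm{sp}(V^*),1\}\,\log\big(T\,\mathcal B_{\mathcal H}(1/T)/\delta\big)$$ satisfies $$\mathrm{Reg}(T)\le C\,\big(1+p(\log T)\big)\,\mathrm{sp}(V^*)\,d\,\sqrt{T\beta},\qquad d=d_{\rm G}\sqrt{\kappa_{\rm G}}.$$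 -/

import Mathlib

open MeasureTheory ProbabilityTheory
open scoped ENNReal NNReal

namespace AvgReward

noncomputable section

universe u v w

variable {S : Type u} [MeasurableSpace S] {A : Type v} [MeasurableSpace A]

/-- An average-reward Markov decision process with deterministic reward `r : S × A → [-1, 1]` and
transition kernel `P`. -/
structure AMDP (S : Type u) [MeasurableSpace S] (A : Type v) [MeasurableSpace A] where
  r : S → A → ℝ
  measurable_r : Measurable fun z : S × A => r z.1 z.2
  r_mem : ∀ s a, r s a ∈ Set.Icc (-1 : ℝ) 1
  P : Kernel (S × A) S
  markov : IsMarkovKernel P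

/-- `V(s) = max_a Q(s, a)` (the action set is finite and nonempty wherever this is used). -/
def greedyValue (Q : S → A → ℝ) (s : S) : ℝ := ⨆ a, Q s a

/-- The span `sp(V) = sup_{s, s'} |V(s) - V(s')|` (used for bounded `V`). -/
def spanOf (V : S → ℝ) : ℝ := ⨆ z : S × S, |V z.1 - V z.2|

/-- The Bellman optimality equation for the reward `r` and the transition law `P(· | s, a)`:
`J + Q(s, a) = r(s, a) + E_{s' ∼ P(·|s, a)} V(s')` with `V(s) = max_a Q(s, a)`, for a bounded
measurable `Q` and a constant `J ∈ [-1, 1]`. -/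
structure BellmanOptimality (r : S → A → ℝ) (P : S → A → Measure S) (Q : S → A → ℝ) (J : ℝ) :
    Prop where
  measurable_Q : Measurable fun z : S × A => Q z.1 z.2
  bounded_Q : ∃ K : ℝ, ∀ s a, |Q s a| ≤ K
  J_mem : J ∈ Set.Icc (-1 : ℝ) 1
  equation : ∀ s a, J + Q s a = r s a + ∫ s', greedyValue Q s' ∂(P s a)

/-- A model-based hypothesis `f = (P_f, r_f)`, with its bias function `Q_f` and its average reward
`J_f` solving the Bellman optimality equation of the model `(P_f, r_f)`. The transition law is
given by a density `dens s a s' = P_f(s' | s, a)` with respect to a reference measure `ν (s, a)`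
shared by all hypotheses (for instance one fixed measure on `S`, for all `(s, a)`). -/
structure Hypothesis (ν : Kernel (S × A) S) where
  dens : S → A → S → ℝ≥0
  measurable_dens : Measurable fun z : S × A × S => dens z.1 z.2.1 z.2.2
  lintegral_dens : ∀ s a, ∫⁻ s', (dens s a s' : ℝ≥0∞) ∂(ν (s, a)) = 1
  r : S → A → ℝ
  measurable_r : Measurable fun z : S × A => r z.1 z.2
  r_mem : ∀ s a, r s a ∈ Set.Icc (-1 : ℝ) 1
  Q : S → A → ℝ
  J : ℝ
  bellman : BellmanOptimality r
    (fun s a => (ν (s, a)).withDensity fun s' => (dens s a s' : ℝ≥0∞)) Q J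

variable {ν : Kernel (S × A) S}

namespace Hypothesis

/-- The transition law `P_f(· | s, a)`. -/
def transition (f : Hypothesis ν) (s : S) (a : A) : Measure S :=
  (ν (s, a)).withDensity fun s' => (f.dens s a s' : ℝ≥0∞)

/-- `V_f = max_a Q_f(·, a)`. -/
def V (f : Hypothesis ν) : S → ℝ := greedyValue f.Q

/-- `f` is the hypothesis of the true model `M`, whose Bellman optimality equation is solved by
`(Qstar, Jstar)`. -/
structure IsTrueModel (f : Hypothesis ν) (M : AMDP S A) (Qstar : S → A → ℝ) (Jstar : ℝ) :
    Prop where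
  r_eq : f.r = M.r
  transition_eq : ∀ s a, f.transition s a = M.P (s, a)
  Q_eq : f.Q = Qstar
  J_eq : f.J = Jstar

end Hypothesis

/-- Total variation distance
`TV(P_f(·|s, a), P_g(·|s, a)) = (1/2) ∫ |P_f(s'|s, a) - P_g(s'|s, a)|`. -/
def tvDist (f g : Hypothesis ν) (s : S) (a : A) : ℝ :=
  (1 / 2) * ∫ s', |(f.dens s a s' : ℝ) - (g.dens s a s' : ℝ)| ∂(ν (s, a))

/-- The average-reward Bellman error
`E(f)(s, a) = Q_f(s, a) - (r(s, a) + E_{s' ∼ P(·|s, a)} V_f(s') - J_f)` under the true model. -/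
def bellmanError (M : AMDP S A) (f : Hypothesis ν) (s : S) (a : A) : ℝ :=
  f.Q s a - (M.r s a + ∫ s', f.V s' ∂(M.P (s, a)) - f.J)

/-- The MLE discrepancy `l(g, (s, a, s')) = (1/2) |P_g(s'|s, a) / P_{f*}(s'|s, a) - 1|`. -/
def mleDiscrepancy (fstar g : Hypothesis ν) (s : S) (a : A) (s' : S) : ℝ :=
  (1 / 2) * |(g.dens s a s' : ℝ) / (fstar.dens s a s' : ℝ) - 1|

/-- The expected MLE discrepancy at `(s, a)`, the next state being drawn from the true kernel. -/
def expDiscrepancy (M : AMDP S A) (fstar g : Hypothesis ν) (s : S) (a : A) : ℝ :=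
  ∫ s', mleDiscrepancy fstar g s a s' ∂(M.P (s, a))

/-- MLE-Bellman dominance with coefficient `d`, over all sequences of hypotheses of the class and
of state-action pairs. -/
def MLEDominance (M : AMDP S A) (H : Set (Hypothesis ν)) (fstar : Hypothesis ν) (sp : ℝ)
    (T : ℕ) (d : ℝ) : Prop :=
  ∀ (f : ℕ → Hypothesis ν) (s : ℕ → S) (a : ℕ → A), (∀ t ∈ Finset.Icc 1 T, f t ∈ H) →
    ∑ t ∈ Finset.Icc 1 T, bellmanError M (f t) (s t) (a t) ≤
      d * sp * ∑ t ∈ Finset.Icc 1 T, |expDiscrepancy M fstar (f t) (s t) (a t)|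

/-- MLE-transferability with coefficient `κ`, for every radius `β > 0` and over all sequences of
hypotheses of the class and of state-action pairs; `p` is the polynomial in `poly(log T)`. -/
def MLETransferability (M : AMDP S A) (H : Set (Hypothesis ν)) (fstar : Hypothesis ν) (sp : ℝ)
    (T : ℕ) (C₁ : ℝ) (p : Polynomial ℝ) (ε κ : ℝ) : Prop :=
  ∀ (β : ℝ), 0 < β →
  ∀ (f : ℕ → Hypothesis ν) (s : ℕ → S) (a : ℕ → A), (∀ t ∈ Finset.Icc 1 T, f t ∈ H) →
    (∀ t ∈ Finset.Icc 1 T,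
      ∑ i ∈ Finset.Icc 1 (t - 1), |expDiscrepancy M fstar (f t) (s i) (a i)| ≤ √(β * t)) →
    ∑ t ∈ Finset.Icc 1 T, |expDiscrepancy M fstar (f t) (s t) (a t)| ≤
      p.eval (Real.log T) * √(κ * β * T) + C₁ * sp ^ 2 * min κ T + 2 * T * ε ^ 2

/-- `(d, κ)` are the MLE-AGEC coefficients: the smallest `d ≥ 1` and `κ ≥ 1` for which dominance
and transferability hold. -/
structure IsMLEAGEC (M : AMDP S A) (H : Set (Hypothesis ν)) (fstar : Hypothesis ν) (sp : ℝ)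
    (T : ℕ) (C₁ : ℝ) (p : Polynomial ℝ) (ε d κ : ℝ) : Prop where
  least_d : IsLeast {x : ℝ | 1 ≤ x ∧ MLEDominance M H fstar sp T x} d
  least_κ : IsLeast {x : ℝ | 1 ≤ x ∧ MLETransferability M H fstar sp T C₁ p ε x} κ

/-- `U` is a `ρ`-bracket of the densities of the class: every density `P_f`, `f ∈ H`, lies
pointwise below some `u ∈ U` with `∫ (u - P_f)(s' | s, a) ≤ ρ` for every `(s, a)`. -/
def IsBracket (H : Set (Hypothesis ν)) (ρ : ℝ) (U : Set (S → A → S → ℝ≥0)) : Prop :=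
  (∀ u ∈ U, Measurable fun z : S × A × S => u z.1 z.2.1 z.2.2) ∧
  ∀ f ∈ H, ∃ u ∈ U, (∀ s a s', f.dens s a s' ≤ u s a s') ∧
    ∀ s a, ∫⁻ s', ((u s a s' - f.dens s a s' : ℝ≥0) : ℝ≥0∞) ∂(ν (s, a)) ≤ ENNReal.ofReal ρ

/-- The bracketing number: the least cardinality of a `ρ`-bracket. -/
def bracketingNumber (H : Set (Hypothesis ν)) (ρ : ℝ) : ℕ∞ :=
  ⨅ (U : Set (S → A → S → ℝ≥0)) (_ : IsBracket H ρ U), U.encard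

/-- The negative log-likelihood `L_D(g) = - ∑_{(s, a, s') ∈ D} log P_g(s' | s, a) ∈ (-∞, ∞]` on
the data `D = {(s_i, a_i, s_{i+1}) : 1 ≤ i ≤ n}`. -/
def negLogLik (s : ℕ → S) (a : ℕ → A) (n : ℕ) (g : Hypothesis ν) : EReal :=
  ∑ i ∈ Finset.Icc 1 n, -ENNReal.log (g.dens (s i) (a i) (s (i + 1)) : ℝ≥0∞)

/-- The confidence set `{f ∈ H : L_D(f) - inf_{g ∈ H} L_D(g) ≤ β}` built on the first `n`
transitions. -/
def confidenceSet (H : Set (Hypothesis ν)) (β : ℝ) (s : ℕ → S) (a : ℕ → A) (n : ℕ) :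
    Set (Hypothesis ν) :=
  {f | f ∈ H ∧ negLogLik s a n f ≤ (⨅ g ∈ H, negLogLik s a n g) + (β : EReal)}

/-- The update statistic `Υ_t = ∑_{i ≤ t} TV(P_{f_t}(·|s_i, a_i), P_{g_t}(·|s_i, a_i))`. -/
def upsilon (s : ℕ → S) (a : ℕ → A) (f g : ℕ → Hypothesis ν) (t : ℕ) : ℝ :=
  ∑ i ∈ Finset.Icc 1 t, tvDist (f t) (g t) (s i) (a i)

/-- One trajectory of MLE-LOOP (with auxiliary class equal to `H`) over the horizon `T`: states
`s t`, actions `a t`, executed hypotheses `f t`, maximum likelihood estimators `g t`. -/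
structure IsMLELoopPath (H : Set (Hypothesis ν)) (β : ℝ) (T : ℕ) (s : ℕ → S) (a : ℕ → A)
    (f g : ℕ → Hypothesis ν) : Prop where
  /-- At a switch, `f_t` maximizes `J` over the confidence set. -/
  switch : ∀ t ∈ Finset.Icc 1 T, (t = 1 ∨ 3 * √(β * t) ≤ upsilon s a f g (t - 1)) →
    f t ∈ confidenceSet H β s a (t - 1) ∧ ∀ h ∈ confidenceSet H β s a (t - 1), h.J ≤ (f t).J
  /-- Otherwise the hypothesis is retained. -/
  stay : ∀ t ∈ Finset.Icc 1 T, ¬(t = 1 ∨ 3 * √(β * t) ≤ upsilon s a f g (t - 1)) →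
    f t = f (t - 1)
  /-- `g_t` minimizes the negative log-likelihood of the data collected before step `t`. -/
  mle : ∀ t ∈ Finset.Icc 1 T, g t ∈ H ∧ ∀ h ∈ H, negLogLik s a (t - 1) (g t) ≤
    negLogLik s a (t - 1) h
  /-- The executed action is greedy. -/
  greedy : ∀ t ∈ Finset.Icc 1 T, ∀ b, (f t).Q (s t) b ≤ (f t).Q (s t) (a t)

/-- The stochastic process generated by MLE-LOOP interacting with `M` from the initial state `s₁`:
almost every path follows the algorithm, and given the information `ℱ t` available once `a_t` is
chosen, the next state has law `M.P (s_t, a_t)`. -/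
structure IsMLELoopProcess (M : AMDP S A) (H : Set (Hypothesis ν)) (β : ℝ) (T : ℕ) (s₁ : S)
    {Ω : Type w} [mΩ : MeasurableSpace Ω] (μ : Measure Ω) (ℱ : Filtration ℕ mΩ)
    (s : ℕ → Ω → S) (a : ℕ → Ω → A) (f g : ℕ → Ω → Hypothesis ν) : Prop where
  measurable_s : ∀ t, Measurable[ℱ t] (s t)
  measurable_a : ∀ t, Measurable[ℱ t] (a t)
  measurable_V : ∀ t ∈ Finset.Icc 1 T,
    @Measurable (Ω × S) ℝ ((ℱ t).prod inferInstance) _ fun z => (f t z.1).V z.2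
  initial : ∀ᵐ ω ∂μ, s 1 ω = s₁
  path : ∀ᵐ ω ∂μ, IsMLELoopPath H β T (fun t => s t ω) (fun t => a t ω) (fun t => f t ω)
    (fun t => g t ω)
  transition : ∀ t ∈ Finset.Icc 1 T, ∀ F : Set Ω, MeasurableSet[ℱ t] F →
    ∀ B : Set S, MeasurableSet B →
      μ (F ∩ s (t + 1) ⁻¹' B) = ∫⁻ ω in F, M.P (s t ω, a t ω) B ∂μ

/-- The regret `∑_{t ≤ T} (J* - r(s_t, a_t))` of a trajectory. -/
def regret (M : AMDP S A) (Jstar : ℝ) (T : ℕ) (s : ℕ → S) (a : ℕ → A) : ℝ :=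
  ∑ t ∈ Finset.Icc 1 T, (Jstar - M.r (s t) (a t))

/-- The optimistic parameter `β = c · max(sp, 1) · log(T · B / δ)`. -/
def optimisticParameter (c sp : ℝ) (T B : ℕ) (δ : ℝ) : ℝ :=
  c * max sp 1 * Real.log (T * B / δ)

end

end AvgReward

open AvgReward

/-!
The regret of MLE-LOOP splits, by optimism and the Bellman equation, into Bellman errors, a
martingale and a telescoping sum of values (`IsMLELoopPath.regret_le`).

*Statistics.* For an upper bracket `u` of a density, with affinity
`Z = ∫ √(u P_{f*})`, the factor `√(u / P_{f*}) exp (1 - Z)` has conditional expectation at most one,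
so the products of these factors along the trajectory have expectation at most one. Markov's
inequality and a union bound over the brackets and the times control all likelihood ratios at once
(`IsMLELoopProcess.measure_ratio_le`). Since `1 - Z` is, up to the bracket width, half a squared
Hellinger distance, the true model stays in all confidence sets, and every hypothesis with nearly
maximal likelihood has total variation `O(√(β t))` to the truth on the data
(`likelihoodControl_of_ratio`).

*Bellman errors.* The executed hypotheses therefore have total variation at most `5 √(β t)` on the
past (`IsMLELoopPath.sum_tvDist_le`), so transferability with radius `25 β` bounds the sum `X` of
the discrepancies `ℓ_{f_t}(s_t, a_t)`, and dominance bounds the sum of the Bellman errors by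
`d sp X`.

*Switches.* Within an epoch the values telescope, and a switch costs at most the span. The threshold
`3 √(β t)` exceeds what the confidence sets at the two ends of an epoch explain, so each closed
epoch carries total variation at least one (`IsMLELoopPath.one_le_sum_tvDist`). As total variation
is at most twice the discrepancy, there are at most `2 X` switches after the first choice.

*Burn-in.* The term `C₁ sp² min(κ, T)` in `X` can exceed `√(κ T β)`, but only when the claimed bound
is above the trivial bound `2 T` on the regret (`burn_in_le`).
-/

namespace AvgReward

theorem integrable_coe_of_lintegral_eq_one {X : Type*} [MeasurableSpace X] {m : Measure X}
    {q : X → ℝ≥0} (hq : Measurable q) (h1 : ∫⁻ x, (q x : ℝ≥0∞) ∂m = 1) :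
    Integrable (fun x => (q x : ℝ)) m ∧ ∫ x, (q x : ℝ) ∂m = 1 := by
  have hI : Integrable (fun x => (q x : ℝ)) m := by
    refine ⟨hq.coe_nnreal_real.aestronglyMeasurable, ?_⟩
    simp [HasFiniteIntegral, enorm_eq_nnnorm, h1]
  refine ⟨hI, ?_⟩
  rw [integral_eq_lintegral_of_nonneg_ae (ae_of_all _ fun x => (q x).coe_nonneg)
    hq.coe_nnreal_real.aestronglyMeasurable]
  simp [h1]

/-! ### Brackets, total variation and Hellinger affinity -/

section Bracket

variable {X : Type*} [MeasurableSpace X] {m : Measure X} {u q p : X → ℝ≥0} {ρ : ℝ}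

theorem integrable_bracket (hu : Measurable u) (hq : Measurable q)
    (hq1 : ∫⁻ x, (q x : ℝ≥0∞) ∂m = 1) (hle : ∀ x, q x ≤ u x) (hρ : 0 ≤ ρ)
    (hb : ∫⁻ x, ((u x - q x : ℝ≥0) : ℝ≥0∞) ∂m ≤ ENNReal.ofReal ρ) :
    Integrable (fun x => (u x : ℝ)) m ∧ ∫ x, (u x : ℝ) ∂m ≤ 1 + ρ := by
  obtain ⟨hqI, hq1'⟩ := integrable_coe_of_lintegral_eq_one hq hq1
  have hd : Integrable (fun x => ((u x - q x : ℝ≥0) : ℝ)) m := by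
    refine ⟨(hu.sub hq).coe_nnreal_real.aestronglyMeasurable, ?_⟩
    simp only [HasFiniteIntegral, enorm_eq_nnnorm, NNReal.nnnorm_eq]
    exact hb.trans_lt ENNReal.ofReal_lt_top
  have hdle : ∫ x, ((u x - q x : ℝ≥0) : ℝ) ∂m ≤ ρ := by
    rw [integral_eq_lintegral_of_nonneg_ae (ae_of_all _ fun x => NNReal.coe_nonneg _)
      hd.aestronglyMeasurable]
    simp only [ENNReal.ofReal_coe_nnreal]
    exact ENNReal.toReal_le_of_le_ofReal hρ hb
  have he : (fun x => (u x : ℝ)) = fun x => (q x : ℝ) + ((u x - q x : ℝ≥0) : ℝ) := by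
    funext x
    rw [NNReal.coe_sub (hle x)]; ring
  rw [he]
  refine ⟨hqI.add hd, ?_⟩
  rw [integral_add hqI hd, hq1']
  linarith

theorem integrable_sqrt_mul (hu : Measurable u) (hp : Measurable p)
    (huI : Integrable (fun x => (u x : ℝ)) m) (hpI : Integrable (fun x => (p x : ℝ)) m) :
    Integrable (fun x => √((u x : ℝ) * p x)) m := by
  refine (huI.add hpI).mono'
    ((hu.coe_nnreal_real.mul hp.coe_nnreal_real).sqrt).aestronglyMeasurable
    (ae_of_all _ fun x => ?_)
  rw [Real.norm_of_nonneg (Real.sqrt_nonneg _)]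
  have h1 := (u x).coe_nonneg
  have h2 := (p x).coe_nonneg
  refine Real.sqrt_le_iff.2 ⟨by simp only [Pi.add_apply]; positivity, ?_⟩
  simp only [Pi.add_apply]
  nlinarith

/-- The Hellinger affinity of an upper bracket with a density exceeds one by at most half the
width of the bracket. -/
theorem integral_sqrt_mul_le (hu : Measurable u) (hq : Measurable q) (hp : Measurable p)
    (hq1 : ∫⁻ x, (q x : ℝ≥0∞) ∂m = 1) (hp1 : ∫⁻ x, (p x : ℝ≥0∞) ∂m = 1)
    (hle : ∀ x, q x ≤ u x) (hρ : 0 ≤ ρ)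
    (hb : ∫⁻ x, ((u x - q x : ℝ≥0) : ℝ≥0∞) ∂m ≤ ENNReal.ofReal ρ) :
    ∫ x, √((u x : ℝ) * p x) ∂m ≤ 1 + ρ / 2 := by
  obtain ⟨huI, hu1⟩ := integrable_bracket hu hq hq1 hle hρ hb
  obtain ⟨hpI, hp1'⟩ := integrable_coe_of_lintegral_eq_one hp hp1
  have h : ∫ x, √((u x : ℝ) * p x) ∂m ≤ ∫ x, ((u x : ℝ) + p x) / 2 ∂m := by
    refine integral_mono (integrable_sqrt_mul hu hp huI hpI) ((huI.add hpI).div_const 2)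
      fun x => ?_
    have h1 := (u x).coe_nonneg
    have h2 := (p x).coe_nonneg
    refine Real.sqrt_le_iff.2 ⟨by positivity, ?_⟩
    nlinarith [sq_nonneg ((u x : ℝ) - p x)]
  rw [integral_div, integral_add huI hpI, hp1'] at h
  linarith

/-- Total variation against Hellinger affinity. The Cauchy-Schwarz inequality
`|u - p| = |√u - √p| (√u + √p)` is used in the linearised form `2 ab ≤ x a² + b² / x`, so that the
weight `x` can be chosen after summation over the data. -/
theorem half_integral_abs_sub_le (hu : Measurable u) (hq : Measurable q) (hp : Measurable p)
    (hq1 : ∫⁻ x, (q x : ℝ≥0∞) ∂m = 1) (hp1 : ∫⁻ x, (p x : ℝ≥0∞) ∂m = 1)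
    (hle : ∀ x, q x ≤ u x) (hρ : 0 ≤ ρ)
    (hb : ∫⁻ x, ((u x - q x : ℝ≥0) : ℝ≥0∞) ∂m ≤ ENNReal.ofReal ρ) {x : ℝ} (hx : 0 < x) :
    (1 / 2) * ∫ y, |(q y : ℝ) - p y| ∂m ≤
      ρ / 2 + (x * (2 + ρ - 2 * ∫ y, √((u y : ℝ) * p y) ∂m) + 2 * (2 + ρ) / x) / 4 := by
  obtain ⟨huI, hu1⟩ := integrable_bracket hu hq hq1 hle hρ hb
  obtain ⟨hqI, hq1'⟩ := integrable_coe_of_lintegral_eq_one hq hq1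
  obtain ⟨hpI, hp1'⟩ := integrable_coe_of_lintegral_eq_one hp hp1
  have hZ := integrable_sqrt_mul hu hp huI hpI
  have hpt : ∀ y, |(q y : ℝ) - p y| ≤ ((u y : ℝ) - q y) +
      ((x / 2 + 1 / x) * ((u y : ℝ) + p y) - x * √((u y : ℝ) * p y)) := by
    intro y
    have h1 := (u y).coe_nonneg
    have h2 := (p y).coe_nonneg
    have h3 : (q y : ℝ) ≤ u y := NNReal.coe_le_coe.2 (hle y)
    have h4 : |(q y : ℝ) - p y| ≤ ((u y : ℝ) - q y) + |(u y : ℝ) - p y| := by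
      have := abs_sub_le (q y : ℝ) (u y) (p y)
      rwa [abs_sub_comm (q y : ℝ) (u y), abs_of_nonneg (sub_nonneg.2 h3)] at this
    have h5 : |(u y : ℝ) - p y| ≤
        (x / 2 + 1 / x) * ((u y : ℝ) + p y) - x * √((u y : ℝ) * p y) := by
      rw [Real.sqrt_mul h1]
      obtain ⟨a, ha, hau⟩ : ∃ a, 0 ≤ a ∧ (u y : ℝ) = a ^ 2 :=
        ⟨√(u y), Real.sqrt_nonneg _, (Real.sq_sqrt h1).symm⟩
      obtain ⟨b, hb', hbp⟩ : ∃ b, 0 ≤ b ∧ (p y : ℝ) = b ^ 2 :=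
        ⟨√(p y), Real.sqrt_nonneg _, (Real.sq_sqrt h2).symm⟩
      rw [hau, hbp, Real.sqrt_sq ha, Real.sqrt_sq hb']
      have e : a ^ 2 - b ^ 2 = (a - b) * (a + b) := by ring
      have hkey : ∀ c : ℝ, c ^ 2 = (a - b) ^ 2 → c * (a + b) ≤
          (x / 2 + 1 / x) * (a ^ 2 + b ^ 2) - x * (a * b) := by
        intro c hc
        have hy : (x / 2 + 1 / x) * (a ^ 2 + b ^ 2) - x * (a * b) - c * (a + b)
            = (x * c - (a + b)) ^ 2 / (2 * x) + (a - b) ^ 2 / (2 * x) := by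
          have hc' : (x * c - (a + b)) ^ 2 = x ^ 2 * (a - b) ^ 2 - 2 * x * c * (a + b)
              + (a + b) ^ 2 := by rw [← hc]; ring
          rw [hc']
          field_simp
          ring
        have : 0 ≤ (x * c - (a + b)) ^ 2 / (2 * x) + (a - b) ^ 2 / (2 * x) := by positivity
        linarith
      rw [e, abs_le']
      refine ⟨hkey _ rfl, ?_⟩
      have := hkey (-(a - b)) (by ring)
      linarith
    linarith
  have hi : ∫ y, |(q y : ℝ) - p y| ∂m ≤ ∫ y, (((u y : ℝ) - q y) +
      ((x / 2 + 1 / x) * ((u y : ℝ) + p y) - x * √((u y : ℝ) * p y))) ∂m :=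
    integral_mono (hqI.sub hpI).abs
      ((huI.sub hqI).add (((huI.add hpI).const_mul _).sub (hZ.const_mul _))) hpt
  have hrw : ∫ y, (((u y : ℝ) - q y) +
      ((x / 2 + 1 / x) * ((u y : ℝ) + p y) - x * √((u y : ℝ) * p y))) ∂m =
      (∫ y, (u y : ℝ) ∂m - 1) + ((x / 2 + 1 / x) * (∫ y, (u y : ℝ) ∂m + 1)
        - x * ∫ y, √((u y : ℝ) * p y) ∂m) := by
    have hA : Integrable (fun y => (x / 2 + 1 / x) * ((u y : ℝ) + p y)) m :=
      (huI.add hpI).const_mul _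
    have hB : Integrable (fun y => x * √((u y : ℝ) * p y)) m := hZ.const_mul _
    rw [integral_add (f := fun y => (u y : ℝ) - q y)
      (g := fun y => (x / 2 + 1 / x) * ((u y : ℝ) + p y) - x * √((u y : ℝ) * p y))
      (huI.sub hqI) (hA.sub hB),
      integral_sub huI hqI, integral_sub hA hB,
      integral_const_mul, integral_const_mul, integral_add huI hpI, hq1', hp1']
  rw [hrw] at hi
  have hm : (x / 2 + 1 / x) * (∫ y, (u y : ℝ) ∂m + 1) ≤ (x / 2 + 1 / x) * (2 + ρ) :=
    mul_le_mul_of_nonneg_left (by linarith) (by positivity)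
  have e2 : 2 * (2 + ρ) / x = 2 * ((1 / x) * (2 + ρ)) := by ring
  rw [e2]
  nlinarith

end Bracket

/-! ### Total variation and the MLE discrepancy -/

section Hypothesis

variable {S : Type*} [MeasurableSpace S] {A : Type*} [MeasurableSpace A] {ν : Kernel (S × A) S}

theorem Hypothesis.measurable_dens_apply (f : Hypothesis ν) (s : S) (a : A) :
    Measurable (f.dens s a) :=
  f.measurable_dens.comp (measurable_const.prodMk (measurable_const.prodMk measurable_id))

theorem Hypothesis.integrable_dens (f : Hypothesis ν) (s : S) (a : A) :
    Integrable (fun s' => (f.dens s a s' : ℝ)) (ν (s, a)) :=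
  (integrable_coe_of_lintegral_eq_one (f.measurable_dens_apply s a) (f.lintegral_dens s a)).1

theorem Hypothesis.integral_dens (f : Hypothesis ν) (s : S) (a : A) :
    ∫ s', (f.dens s a s' : ℝ) ∂(ν (s, a)) = 1 :=
  (integrable_coe_of_lintegral_eq_one (f.measurable_dens_apply s a) (f.lintegral_dens s a)).2

theorem tvDist_nonneg (f g : Hypothesis ν) (s : S) (a : A) : 0 ≤ tvDist f g s a :=
  mul_nonneg (by norm_num) (integral_nonneg fun _ => abs_nonneg _)

theorem tvDist_comm (f g : Hypothesis ν) (s : S) (a : A) : tvDist f g s a = tvDist g f s a := by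
  simp only [tvDist, abs_sub_comm]

theorem tvDist_le_one (f g : Hypothesis ν) (s : S) (a : A) : tvDist f g s a ≤ 1 := by
  have hf := f.integrable_dens s a
  have hg := g.integrable_dens s a
  have h : ∫ s', |(f.dens s a s' : ℝ) - (g.dens s a s' : ℝ)| ∂(ν (s, a)) ≤
      ∫ s', ((f.dens s a s' : ℝ) + (g.dens s a s' : ℝ)) ∂(ν (s, a)) := by
    refine integral_mono (hf.sub hg).abs (hf.add hg) fun s' => ?_
    have h1 := (f.dens s a s').coe_nonneg
    have h2 := (g.dens s a s').coe_nonneg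
    exact abs_le.2 ⟨by linarith, by linarith⟩
  rw [integral_add hf hg, f.integral_dens, g.integral_dens] at h
  unfold tvDist
  linarith

theorem tvDist_triangle (f g h : Hypothesis ν) (s : S) (a : A) :
    tvDist f h s a ≤ tvDist f g s a + tvDist g h s a := by
  have hf := f.integrable_dens s a
  have hg := g.integrable_dens s a
  have hh := h.integrable_dens s a
  have := integral_mono (hf.sub hh).abs ((hf.sub hg).abs.add (hg.sub hh).abs)
    fun s' => abs_sub_le (f.dens s a s' : ℝ) (g.dens s a s') (h.dens s a s')
  rw [integral_add' (hf.sub hg).abs (hg.sub hh).abs] at this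
  simp only [Pi.sub_apply] at this
  unfold tvDist
  linarith

variable {M : AMDP S A} {Qstar : S → A → ℝ} {Jstar : ℝ} {fstar : Hypothesis ν}

theorem expDiscrepancy_eq (hM : fstar.IsTrueModel M Qstar Jstar) (g : Hypothesis ν)
    (s : S) (a : A) :
    expDiscrepancy M fstar g s a = (1 / 2) * ∫ s', (fstar.dens s a s' : ℝ) *
      |(g.dens s a s' : ℝ) / (fstar.dens s a s' : ℝ) - 1| ∂(ν (s, a)) := by
  rw [expDiscrepancy, ← hM.transition_eq s a, Hypothesis.transition,
    integral_withDensity_eq_integral_smul (fstar.measurable_dens_apply s a),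
    ← integral_const_mul]
  refine integral_congr_ae (ae_of_all _ fun s' => ?_)
  simp only [mleDiscrepancy, NNReal.smul_def, smul_eq_mul]
  ring

theorem expDiscrepancy_nonneg (M : AMDP S A) (fstar g : Hypothesis ν) (s : S) (a : A) :
    0 ≤ expDiscrepancy M fstar g s a :=
  integral_nonneg fun _ => mul_nonneg (by norm_num) (abs_nonneg _)

theorem mul_abs_div_sub_one_eq (f p : ℝ≥0) :
    (p : ℝ) * |(f : ℝ) / p - 1| = if p = 0 then 0 else |(f : ℝ) - p| := by
  split_ifs with h
  · simp [h]
  · have hp : (0 : ℝ) < p := NNReal.coe_pos.2 (pos_iff_ne_zero.2 h)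
    rw [← abs_of_pos hp, ← abs_mul, abs_of_pos hp]
    congr 1
    field_simp

theorem integrable_mul_abs_div (fstar g : Hypothesis ν) (s : S) (a : A) :
    Integrable (fun s' => (fstar.dens s a s' : ℝ) *
      |(g.dens s a s' : ℝ) / (fstar.dens s a s' : ℝ) - 1|) (ν (s, a)) := by
  have hf := (fstar.measurable_dens_apply s a).coe_nnreal_real
  have hg := (g.measurable_dens_apply s a).coe_nnreal_real
  refine ((g.integrable_dens s a).sub (fstar.integrable_dens s a)).abs.mono'
    (hf.mul ((hg.div hf).sub_const 1).abs).aestronglyMeasurable (ae_of_all _ fun s' => ?_)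
  rw [mul_abs_div_sub_one_eq]
  split_ifs <;> simp

theorem expDiscrepancy_le_tvDist (hM : fstar.IsTrueModel M Qstar Jstar) (g : Hypothesis ν)
    (s : S) (a : A) : expDiscrepancy M fstar g s a ≤ tvDist g fstar s a := by
  rw [expDiscrepancy_eq hM, tvDist]
  refine mul_le_mul_of_nonneg_left (integral_mono (integrable_mul_abs_div fstar g s a)
    ((g.integrable_dens s a).sub (fstar.integrable_dens s a)).abs fun s' => ?_) (by norm_num)
  simp only [mul_abs_div_sub_one_eq]
  split_ifs <;> simp

/-- The MLE discrepancy ignores the mass which `P_g` puts where the true density vanishes, but that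
mass is at most the deficit of `P_g` where the true density is positive. -/
theorem tvDist_le_two_mul_expDiscrepancy (hM : fstar.IsTrueModel M Qstar Jstar)
    (g : Hypothesis ν) (s : S) (a : A) :
    tvDist g fstar s a ≤ 2 * expDiscrepancy M fstar g s a := by
  rw [expDiscrepancy_eq hM, tvDist]
  have hg := g.integrable_dens s a
  have hf := fstar.integrable_dens s a
  have hI := integrable_mul_abs_div fstar g s a
  have h := integral_mono (hg.sub hf).abs ((hI.const_mul 2).add (hg.sub hf)) fun s' => by
    show |(g.dens s a s' : ℝ) - fstar.dens s a s'| ≤ 2 * ((fstar.dens s a s' : ℝ) *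
      |(g.dens s a s' : ℝ) / (fstar.dens s a s' : ℝ) - 1|) +
      ((g.dens s a s' : ℝ) - fstar.dens s a s')
    rw [mul_abs_div_sub_one_eq]
    split_ifs with h0
    · simp [h0]
    · linarith [neg_abs_le ((g.dens s a s' : ℝ) - fstar.dens s a s')]
  rw [integral_add' (hI.const_mul 2) (hg.sub hf), integral_sub' hg hf, g.integral_dens,
    fstar.integral_dens, integral_const_mul] at h
  simp only [Pi.sub_apply] at h
  linarith

end Hypothesis

/-! ### Likelihoods -/

section Likelihood

variable {S : Type*} [MeasurableSpace S] {A : Type*} [MeasurableSpace A] {ν : Kernel (S × A) S}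

/-- The likelihood `∏_{i ≤ n} P_g(s_{i+1} | s_i, a_i)` of the first `n` transitions. -/
noncomputable def likelihood (s : ℕ → S) (a : ℕ → A) (n : ℕ) (g : Hypothesis ν) : ℝ≥0 :=
  ∏ i ∈ Finset.Icc 1 n, g.dens (s i) (a i) (s (i + 1))

theorem negLogLik_eq (s : ℕ → S) (a : ℕ → A) (n : ℕ) (g : Hypothesis ν) :
    negLogLik s a n g = -ENNReal.log (likelihood s a n g : ℝ≥0∞) := by
  unfold negLogLik likelihood
  induction Finset.Icc 1 n using Finset.induction_on with
  | empty => simp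
  | insert i F hi ih =>
    rw [Finset.sum_insert hi, Finset.prod_insert hi, ih, ENNReal.coe_mul, ENNReal.log_mul_add,
      EReal.neg_add, sub_eq_add_neg]
    · exact Or.inr (mt ENNReal.log_eq_top_iff.1 ENNReal.coe_ne_top)
    · left; simp

theorem log_coe_of_pos {x : ℝ≥0} (hx : 0 < x) :
    ENNReal.log (x : ℝ≥0∞) = ((Real.log x : ℝ) : EReal) := by
  rw [ENNReal.log_pos_real (by simpa using hx.ne') (by simp)]
  simp

/-- With a positive reference likelihood `y`, a comparison of extended-real negative log-likelihoods
is a comparison of likelihoods. -/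
theorem neg_log_le_neg_log_add_iff {x y : ℝ≥0} (hy : 0 < y) (b : ℝ) :
    -ENNReal.log (x : ℝ≥0∞) ≤ -ENNReal.log (y : ℝ≥0∞) + (b : EReal) ↔
      (y : ℝ) ≤ Real.exp b * x := by
  rcases eq_or_ne x 0 with rfl | hx
  · have h1 : ¬ ((y : ℝ) ≤ 0) := not_le.2 (NNReal.coe_pos.2 hy)
    rw [log_coe_of_pos hy]
    simp only [ENNReal.coe_zero, ENNReal.log_zero, EReal.neg_bot, NNReal.coe_zero, mul_zero, h1,
      iff_false, top_le_iff]
    rw [← EReal.coe_neg, ← EReal.coe_add]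
    exact EReal.coe_ne_top _
  · have hx0 : 0 < x := pos_iff_ne_zero.2 hx
    rw [log_coe_of_pos hy, log_coe_of_pos hx0, ← EReal.coe_neg, ← EReal.coe_neg, ← EReal.coe_add,
      EReal.coe_le_coe_iff]
    rw [← Real.log_le_log_iff (NNReal.coe_pos.2 hy)
      (mul_pos (Real.exp_pos _) (NNReal.coe_pos.2 hx0)),
      Real.log_mul (Real.exp_pos _).ne' (NNReal.coe_pos.2 hx0).ne', Real.log_exp]
    constructor <;> intro h <;> linarith

theorem le_neg_log_add_iff {x y : ℝ≥0} (hy : 0 < y) (b : ℝ) :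
    -ENNReal.log (y : ℝ≥0∞) ≤ -ENNReal.log (x : ℝ≥0∞) + (b : EReal) ↔
      (x : ℝ) ≤ Real.exp b * y := by
  rcases eq_or_ne x 0 with rfl | hx
  · simp only [ENNReal.coe_zero, ENNReal.log_zero, EReal.neg_bot, NNReal.coe_zero]
    rw [EReal.top_add_coe]
    simp only [le_top, true_iff]
    positivity
  · exact neg_log_le_neg_log_add_iff (pos_iff_ne_zero.2 hx) b

end Likelihood

/-! ### Exponential supermartingales along the process -/

section Disintegration

variable {Ω Ω' Z S : Type*} [MeasurableSpace Ω] [MeasurableSpace Ω'] [MeasurableSpace Z]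
  [MeasurableSpace S]

/-- If `Y` has conditional law `κ (X ω)` given the information carried by `π`, then integrating a
function of `(π, Y)` amounts to integrating first against `κ (X ω)`. The information is a map into a
second measurable space so that it can be instantiated with `Ω` itself under a smaller
`σ`-algebra. -/
theorem lintegral_next {μ : Measure Ω} [IsFiniteMeasure μ] {π : Ω → Ω'} (hπ : Measurable π)
    {X : Ω' → Z} (hX : Measurable X) {κ : Kernel Z S} [IsMarkovKernel κ] {Y : Ω → S}
    (hY : Measurable Y)
    (h : ∀ F : Set Ω', MeasurableSet F → ∀ B : Set S, MeasurableSet B →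
      μ (π ⁻¹' F ∩ Y ⁻¹' B) = ∫⁻ ω in π ⁻¹' F, κ (X (π ω)) B ∂μ)
    {φ : Ω' × S → ℝ≥0∞} (hφ : Measurable φ) :
    ∫⁻ ω, φ (π ω, Y ω) ∂μ = ∫⁻ ω, ∫⁻ y, φ (π ω, y) ∂(κ (X (π ω))) ∂μ := by
  have hm : μ.map (fun ω => (π ω, Y ω)) = (μ.map π) ⊗ₘ (κ.comap X hX) := by
    refine Measure.ext_prod fun {F B} hF hB => ?_
    rw [Measure.map_apply (hπ.prodMk hY) (hF.prod hB), Measure.compProd_apply_prod hF hB,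
      Set.mk_preimage_prod, h F hF B hB, setLIntegral_map hF (Kernel.measurable_coe _ hB) hπ]
    rfl
  rw [← lintegral_map hφ (hπ.prodMk hY), hm, Measure.lintegral_compProd hφ,
    lintegral_map hφ.lintegral_kernel_prod_right' hπ]
  rfl

theorem measurable_integral_kernel_comp {X : Ω' → Z} (hX : Measurable X) (κ : Kernel Z S)
    [IsSFiniteKernel κ] {v : Ω' × S → ℝ} (hv : Measurable v) :
    Measurable fun ω => ∫ y, v (ω, y) ∂(κ (X ω)) :=
  (hv.stronglyMeasurable.integral_kernel_prod_right' (κ := κ.comap X hX)).measurable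

/-! The product `σ`-algebras below are also used with a `σ`-algebra `ℱ t` on `Ω` other than the
ambient one, hence the statements over an auxiliary space `Ω'`. -/

theorem measurable_prod_mk_comp_fst {X : Ω' → Z} (hX : Measurable X) :
    Measurable fun z : Ω' × S => (X z.1, z.2) := by
  fun_prop

theorem measurable_comp_fst_mul {W : Ω' → ℝ≥0∞} (hW : Measurable W) {φ : Ω' × S → ℝ≥0∞}
    (hφ : Measurable φ) : Measurable fun z : Ω' × S => W z.1 * φ z := by
  fun_prop

theorem measurable_comp_fst_prodMk {w : Ω' → ℝ} (hw : Measurable w) {v : Ω' × S → ℝ}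
    (hv : Measurable v) : Measurable fun z : Ω' × S => (w z.1, v z) := by
  fun_prop

end Disintegration

section Interaction

variable {S : Type*} [MeasurableSpace S] {A : Type*} [MeasurableSpace A] {ν : Kernel (S × A) S}
  {M : AMDP S A} {H : Set (Hypothesis ν)} {β : ℝ} {T : ℕ} {s₁ : S}
  {Ω : Type*} [mΩ : MeasurableSpace Ω] {μ : Measure Ω}
  {ℱ : Filtration ℕ mΩ} {s : ℕ → Ω → S} {a : ℕ → Ω → A} {f g : ℕ → Ω → Hypothesis ν}

theorem IsMLELoopProcess.lintegral_next [IsProbabilityMeasure μ]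
    (hP : IsMLELoopProcess M H β T s₁ μ ℱ s a f g)
    {t : ℕ} (ht : t ∈ Finset.Icc 1 T) {φ : Ω × S → ℝ≥0∞}
    (hφ : @Measurable (Ω × S) ℝ≥0∞ ((ℱ t).prod inferInstance) _ φ) :
    ∫⁻ ω, φ (ω, s (t + 1) ω) ∂μ = ∫⁻ ω, ∫⁻ y, φ (ω, y) ∂(M.P (s t ω, a t ω)) ∂μ := by
  have := M.markov
  exact @AvgReward.lintegral_next Ω Ω (S × A) S mΩ (ℱ t) _ _ μ _ id
    (measurable_id.mono (ℱ.le t) le_rfl) (fun ω => (s t ω, a t ω))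
    ((hP.measurable_s t).prodMk (hP.measurable_a t)) M.P _ (s (t + 1))
    ((hP.measurable_s (t + 1)).mono (ℱ.le _) le_rfl)
    (fun F hF B hB => hP.transition t ht F hF B hB) φ hφ

theorem IsMLELoopProcess.measurable_step (hP : IsMLELoopProcess M H β T s₁ μ ℱ s a f g) (t : ℕ) :
    @Measurable (Ω × S) ((S × A) × S) ((ℱ t).prod inferInstance) _
      (fun z => ((s t z.1, a t z.1), z.2)) := by
  have hsa : Measurable[ℱ t] fun ω => (s t ω, a t ω) :=
    (hP.measurable_s t).prodMk (hP.measurable_a t)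
  exact @measurable_prod_mk_comp_fst Ω (S × A) S (ℱ t) _ _ _ hsa

theorem IsMLELoopProcess.measurable_prod_next (hP : IsMLELoopProcess M H β T s₁ μ ℱ s a f g)
    {φ : ℕ → Ω × S → ℝ≥0∞} {n : ℕ}
    (hφ : ∀ t ∈ Finset.Icc 1 n,
      @Measurable (Ω × S) ℝ≥0∞ ((ℱ t).prod inferInstance) _ (φ t)) :
    Measurable[ℱ (n + 1)] fun ω => ∏ t ∈ Finset.Icc 1 n, φ t (ω, s (t + 1) ω) := by
  refine Finset.measurable_fun_prod _ fun t ht => ?_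
  have htn : t ≤ n := (Finset.mem_Icc.1 ht).2
  have h1 : @Measurable Ω (Ω × S) (ℱ (n + 1)) ((ℱ t).prod inferInstance)
      (fun ω => (ω, s (t + 1) ω)) :=
    (measurable_id'' (ℱ.mono (by omega))).prodMk
      ((hP.measurable_s (t + 1)).mono (ℱ.mono (by omega)) le_rfl)
  exact (hφ t ht).comp h1

/-- Multiplicative supermartingale: factors whose conditional expectations given the past are at
most one have products of expectation at most one. -/
theorem IsMLELoopProcess.lintegral_prod_le_one [IsProbabilityMeasure μ]
    (hP : IsMLELoopProcess M H β T s₁ μ ℱ s a f g)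
    {φ : ℕ → Ω × S → ℝ≥0∞}
    (hφ : ∀ t ∈ Finset.Icc 1 T,
      @Measurable (Ω × S) ℝ≥0∞ ((ℱ t).prod inferInstance) _ (φ t))
    (h1 : ∀ t ∈ Finset.Icc 1 T, ∀ᵐ ω ∂μ, ∫⁻ y, φ t (ω, y) ∂(M.P (s t ω, a t ω)) ≤ 1) :
    ∀ n ≤ T, ∫⁻ ω, ∏ t ∈ Finset.Icc 1 n, φ t (ω, s (t + 1) ω) ∂μ ≤ 1 := by
  intro n
  induction n with
  | zero => intro _; simp
  | succ n ih =>
    intro hn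
    have hmem : n + 1 ∈ Finset.Icc 1 T := Finset.mem_Icc.2 ⟨by omega, hn⟩
    have hsub : ∀ t ∈ Finset.Icc 1 n, t ∈ Finset.Icc 1 T := fun t ht => by
      rw [Finset.mem_Icc] at *; omega
    have hW := hP.measurable_prod_next fun t ht => hφ t (hsub t ht)
    have hψ : @Measurable (Ω × S) ℝ≥0∞ ((ℱ (n + 1)).prod inferInstance) _
        (fun z => (∏ t ∈ Finset.Icc 1 n, φ t (z.1, s (t + 1) z.1)) * φ (n + 1) z) := by
      exact @measurable_comp_fst_mul Ω S (ℱ (n + 1)) _ _ hW _ (hφ _ hmem)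
    have hnext := hP.lintegral_next hmem hψ
    simp_rw [Finset.prod_Icc_succ_top (Nat.le_add_left 1 n)]
    refine hnext.trans_le ?_
    refine le_trans (lintegral_mono_ae ?_) (ih (by omega))
    filter_upwards [h1 _ hmem] with ω hω
    have hmeas : Measurable fun y => φ (n + 1) (ω, y) :=
      (hφ _ hmem).comp (@measurable_prodMk_left Ω S (ℱ (n + 1)) _ ω)
    rw [lintegral_const_mul _ hmeas]
    exact mul_le_of_le_one_right' hω

theorem IsMLELoopProcess.measure_le_prod_le [IsProbabilityMeasure μ]
    (hP : IsMLELoopProcess M H β T s₁ μ ℱ s a f g)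
    {φ : ℕ → Ω × S → ℝ≥0∞}
    (hφ : ∀ t ∈ Finset.Icc 1 T,
      @Measurable (Ω × S) ℝ≥0∞ ((ℱ t).prod inferInstance) _ (φ t))
    (h1 : ∀ t ∈ Finset.Icc 1 T, ∀ᵐ ω ∂μ, ∫⁻ y, φ t (ω, y) ∂(M.P (s t ω, a t ω)) ≤ 1)
    {n : ℕ} (hn : n ≤ T) {K : ℝ} (hK : 0 < K) :
    μ {ω | ENNReal.ofReal K ≤ ∏ t ∈ Finset.Icc 1 n, φ t (ω, s (t + 1) ω)} ≤
      ENNReal.ofReal (1 / K) := by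
  have hsub : ∀ t ∈ Finset.Icc 1 n, t ∈ Finset.Icc 1 T := fun t ht => by
    rw [Finset.mem_Icc] at *; omega
  have hW := (hP.measurable_prod_next fun t ht => hφ t (hsub t ht)).mono (ℱ.le _) le_rfl
  refine (meas_ge_le_lintegral_div hW.aemeasurable (ENNReal.ofReal_pos.2 hK).ne'
    ENNReal.ofReal_ne_top).trans ?_
  rw [ENNReal.ofReal_div_of_pos hK, ENNReal.ofReal_one]
  exact ENNReal.div_le_div_right (hP.lintegral_prod_le_one hφ h1 n hn) _

/-! ### Likelihood ratios of brackets -/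

/-- The Hellinger affinity `∫ √(u · P_{f*})(s' | s, a)` of `u` with the true density. -/
noncomputable def affinity (fstar : Hypothesis ν) (u : S → A → S → ℝ≥0) (s : S) (a : A) : ℝ :=
  ∫ s', √((u s a s' : ℝ) * fstar.dens s a s') ∂(ν (s, a))

/-- `u` is a measurable upper bracket of width `ρ` of the density of `h`. -/
structure Brackets (h : Hypothesis ν) (ρ : ℝ) (u : S → A → S → ℝ≥0) : Prop where
  measurable : Measurable fun z : S × A × S => u z.1 z.2.1 z.2.2
  le : ∀ s a s', h.dens s a s' ≤ u s a s'
  width : ∀ s a, ∫⁻ s', ((u s a s' - h.dens s a s' : ℝ≥0) : ℝ≥0∞) ∂(ν (s, a)) ≤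
    ENNReal.ofReal ρ

/-- The normalised square root of the likelihood ratio of `u` at one transition. Since
`Z exp (1 - Z) ≤ 1` for the affinity `Z`, its conditional expectation is at most one. -/
noncomputable def ratioFactor (fstar : Hypothesis ν) (u : S → A → S → ℝ≥0) (s : S) (a : A)
    (s' : S) : ℝ :=
  √((u s a s' : ℝ) / fstar.dens s a s') * Real.exp (1 - affinity fstar u s a)

theorem ratioFactor_nonneg (fstar : Hypothesis ν) (u : S → A → S → ℝ≥0) (s : S) (a : A)
    (s' : S) : 0 ≤ ratioFactor fstar u s a s' :=
  mul_nonneg (Real.sqrt_nonneg _) (Real.exp_pos _).le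

theorem Brackets.measurable_apply {h : Hypothesis ν} {ρ : ℝ} {u : S → A → S → ℝ≥0}
    (hu : Brackets h ρ u) (s : S) (a : A) : Measurable (u s a) :=
  hu.measurable.comp (measurable_const.prodMk (measurable_const.prodMk measurable_id))

theorem Brackets.affinity_le {h : Hypothesis ν} {ρ : ℝ} {u : S → A → S → ℝ≥0}
    (hu : Brackets h ρ u) (hρ : 0 ≤ ρ) (fstar : Hypothesis ν) (s : S) (a : A) :
    affinity fstar u s a ≤ 1 + ρ / 2 :=
  integral_sqrt_mul_le (hu.measurable_apply s a) (h.measurable_dens_apply s a)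
    (fstar.measurable_dens_apply s a) (h.lintegral_dens s a) (fstar.lintegral_dens s a)
    (hu.le s a) hρ (hu.width s a)

theorem Brackets.tvDist_le {h : Hypothesis ν} {ρ : ℝ} {u : S → A → S → ℝ≥0}
    (hu : Brackets h ρ u) (hρ : 0 ≤ ρ) (fstar : Hypothesis ν) (s : S) (a : A) {x : ℝ}
    (hx : 0 < x) :
    tvDist h fstar s a ≤
      ρ / 2 + (x * (2 + ρ - 2 * affinity fstar u s a) + 2 * (2 + ρ) / x) / 4 :=
  half_integral_abs_sub_le (hu.measurable_apply s a) (h.measurable_dens_apply s a)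
    (fstar.measurable_dens_apply s a) (h.lintegral_dens s a) (fstar.lintegral_dens s a)
    (hu.le s a) hρ (hu.width s a) hx

theorem Brackets.measurable_ratioFactor [IsSFiniteKernel ν] {h : Hypothesis ν} {ρ : ℝ}
    {u : S → A → S → ℝ≥0} (hu : Brackets h ρ u) (fstar : Hypothesis ν) :
    Measurable fun z : (S × A) × S => ratioFactor fstar u z.1.1 z.1.2 z.2 := by
  have e : Measurable fun z : (S × A) × S => (z.1.1, z.1.2, z.2) := by fun_prop
  have h1 : Measurable fun z : (S × A) × S => (u z.1.1 z.1.2 z.2 : ℝ) :=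
    (hu.measurable.comp e).coe_nnreal_real
  have h2 : Measurable fun z : (S × A) × S => (fstar.dens z.1.1 z.1.2 z.2 : ℝ) :=
    (fstar.measurable_dens.comp e).coe_nnreal_real
  have h3 : Measurable fun z : S × A => affinity fstar u z.1 z.2 :=
    measurable_integral_kernel_comp (X := id) measurable_id ν (h1.mul h2).sqrt
  exact (h1.div h2).sqrt.mul ((h3.comp measurable_fst).const_sub 1).exp

theorem Brackets.lintegral_ratioFactor_le_one {h : Hypothesis ν} {ρ : ℝ}
    {u : S → A → S → ℝ≥0} (hu : Brackets h ρ u) (hρ : 0 ≤ ρ) {fstar : Hypothesis ν}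
    {Qstar : S → A → ℝ} {Jstar : ℝ} (hM : fstar.IsTrueModel M Qstar Jstar) (s : S) (a : A) :
    ∫⁻ s', ENNReal.ofReal (ratioFactor fstar u s a s') ∂(M.P (s, a)) ≤ 1 := by
  have hum := hu.measurable_apply s a
  have hpm := fstar.measurable_dens_apply s a
  have hI := integrable_sqrt_mul hum hpm
    (integrable_bracket hum (h.measurable_dens_apply s a) (h.lintegral_dens s a) (hu.le s a) hρ
      (hu.width s a)).1 (fstar.integrable_dens s a)
  have hmeas : Measurable fun s' => ENNReal.ofReal (ratioFactor fstar u s a s') :=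
    ((hum.coe_nnreal_real.div hpm.coe_nnreal_real).sqrt.mul_const _).ennreal_ofReal
  rw [← hM.transition_eq s a, Hypothesis.transition,
    lintegral_withDensity_eq_lintegral_mul _ hpm.coe_nnreal_ennreal hmeas]
  calc _ ≤ ∫⁻ s', ENNReal.ofReal (√((u s a s' : ℝ) * fstar.dens s a s')) *
        ENNReal.ofReal (Real.exp (1 - affinity fstar u s a)) ∂(ν (s, a)) := by
        refine lintegral_mono fun s' => ?_
        simp only [Pi.mul_apply]
        rw [← ENNReal.ofReal_coe_nnreal, ← ENNReal.ofReal_mul (NNReal.coe_nonneg _),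
          ← ENNReal.ofReal_mul (Real.sqrt_nonneg _)]
        refine ENNReal.ofReal_le_ofReal ?_
        rw [ratioFactor, ← mul_assoc]
        refine mul_le_mul_of_nonneg_right ?_ (Real.exp_pos _).le
        refine Real.le_sqrt_of_sq_le ?_
        rw [mul_pow, Real.sq_sqrt (by positivity)]
        rcases eq_or_ne (fstar.dens s a s' : ℝ) 0 with h0 | h0
        · simp [h0]
        · refine le_of_eq ?_
          field_simp
    _ = ENNReal.ofReal (affinity fstar u s a * Real.exp (1 - affinity fstar u s a)) := by
        have hs : Measurable fun s' => ENNReal.ofReal √((u s a s' : ℝ) * fstar.dens s a s') :=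
          (hum.coe_nnreal_real.mul hpm.coe_nnreal_real).sqrt.ennreal_ofReal
        rw [lintegral_mul_const _ hs,
          ← ofReal_integral_eq_lintegral_ofReal hI (ae_of_all _ fun _ => Real.sqrt_nonneg _),
          ← ENNReal.ofReal_mul (integral_nonneg fun _ => Real.sqrt_nonneg _)]
        rfl
    _ ≤ 1 := by
        rw [← ENNReal.ofReal_one]
        refine ENNReal.ofReal_le_ofReal ?_
        have h1 := Real.add_one_le_exp (affinity fstar u s a - 1)
        rw [← neg_sub, Real.exp_neg, mul_inv_le_iff₀ (Real.exp_pos _)]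
        linarith

/-- Uniform control of the likelihood ratios of finitely many brackets at all times. -/
theorem IsMLELoopProcess.measure_ratio_le [IsSFiniteKernel ν] [IsProbabilityMeasure μ]
    (hP : IsMLELoopProcess M H β T s₁ μ ℱ s a f g) {fstar : Hypothesis ν}
    {Qstar : S → A → ℝ} {Jstar : ℝ} (hM : fstar.IsTrueModel M Qstar Jstar) {ρ : ℝ} (hρ : 0 ≤ ρ)
    (U : Finset (S → A → S → ℝ≥0)) (hU : ∀ u ∈ U, ∃ h : Hypothesis ν, Brackets h ρ u)
    {K : ℝ} (hK : 0 < K) :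
    μ {ω | ∃ u ∈ U, ∃ n < T,
      K ≤ ∏ t ∈ Finset.Icc 1 n, ratioFactor fstar u (s t ω) (a t ω) (s (t + 1) ω)} ≤
      ENNReal.ofReal (U.card * T / K) := by
  have hsub : {ω | ∃ u ∈ U, ∃ n < T,
      K ≤ ∏ t ∈ Finset.Icc 1 n, ratioFactor fstar u (s t ω) (a t ω) (s (t + 1) ω)} ⊆
      ⋃ z ∈ U ×ˢ Finset.range T, {ω | ENNReal.ofReal K ≤ ∏ t ∈ Finset.Icc 1 z.2,
        ENNReal.ofReal (ratioFactor fstar z.1 (s t ω) (a t ω) (s (t + 1) ω))} := by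
    rintro ω ⟨u, hu, n, hn, h⟩
    refine Set.mem_iUnion₂.2 ⟨(u, n), Finset.mem_product.2 ⟨hu, Finset.mem_range.2 hn⟩, ?_⟩
    show ENNReal.ofReal K ≤ _
    rw [← ENNReal.ofReal_prod_of_nonneg fun _ _ => ratioFactor_nonneg _ _ _ _ _]
    exact ENNReal.ofReal_le_ofReal h
  refine (measure_mono hsub).trans ((measure_biUnion_finset_le _ _).trans ?_)
  refine (Finset.sum_le_card_nsmul _ _ (ENNReal.ofReal (1 / K)) fun z hz => ?_).trans ?_
  · obtain ⟨hu, hn⟩ := Finset.mem_product.1 hz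
    obtain ⟨h, hb⟩ := hU _ hu
    refine hP.measure_le_prod_le (φ := fun t z' => ENNReal.ofReal
      (ratioFactor fstar z.1 (s t z'.1) (a t z'.1) z'.2)) (fun t _ => ?_)
      (fun t _ => ae_of_all _ fun ω => hb.lintegral_ratioFactor_le_one hρ hM _ _)
      (Finset.mem_range.1 hn).le hK
    refine Measurable.ennreal_ofReal ?_
    have hc := (hb.measurable_ratioFactor fstar).comp (hP.measurable_step t)
    exact hc
  · rw [Finset.card_product, Finset.card_range, nsmul_eq_mul, ← ENNReal.ofReal_natCast,
      ← ENNReal.ofReal_mul (Nat.cast_nonneg _)]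
    refine ENNReal.ofReal_le_ofReal (le_of_eq ?_)
    push_cast
    ring

/-- The true density is almost surely positive along the trajectory. -/
theorem IsMLELoopProcess.ae_dens_pos [IsProbabilityMeasure μ]
    (hP : IsMLELoopProcess M H β T s₁ μ ℱ s a f g)
    {fstar : Hypothesis ν} {Qstar : S → A → ℝ} {Jstar : ℝ}
    (hM : fstar.IsTrueModel M Qstar Jstar) :
    ∀ᵐ ω ∂μ, ∀ t ∈ Finset.Icc 1 T, 0 < fstar.dens (s t ω) (a t ω) (s (t + 1) ω) := by
  refine (Finset.eventually_all _).2 fun t ht => ?_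
  have hm : @Measurable (Ω × S) ℝ≥0 ((ℱ t).prod inferInstance) _
      (fun z => fstar.dens (s t z.1) (a t z.1) z.2) := by
    have e : Measurable fun z : (S × A) × S => (z.1.1, z.1.2, z.2) := by fun_prop
    have hc := (fstar.measurable_dens.comp e).comp (hP.measurable_step t)
    exact hc
  -- the indicator of a vanishing density has zero conditional expectation
  have hφ : Measurable fun x : ℝ≥0 => if x = 0 then (1 : ℝ≥0∞) else 0 :=
    Measurable.ite (measurableSet_singleton 0) measurable_const measurable_const
  have h := hP.lintegral_next ht (hφ.comp hm)
  have h0 : ∀ ω, ∫⁻ y, (if fstar.dens (s t ω) (a t ω) y = 0 then (1 : ℝ≥0∞) else 0)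
      ∂(M.P (s t ω, a t ω)) = 0 := by
    intro ω
    have hpm := fstar.measurable_dens_apply (s t ω) (a t ω)
    have hind : Measurable fun y =>
        if fstar.dens (s t ω) (a t ω) y = 0 then (1 : ℝ≥0∞) else 0 := hφ.comp hpm
    rw [← hM.transition_eq, Hypothesis.transition,
      lintegral_withDensity_eq_lintegral_mul _ hpm.coe_nnreal_ennreal hind]
    refine (lintegral_congr fun y => ?_).trans lintegral_zero
    simp only [Pi.mul_apply]
    split_ifs with h <;> simp [h]
  simp only [Function.comp_apply, h0, lintegral_zero] at h
  have hcomp : Measurable fun ω => fstar.dens (s t ω) (a t ω) (s (t + 1) ω) := by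
    refine fstar.measurable_dens.comp (Measurable.prodMk ?_ (Measurable.prodMk ?_ ?_))
    · exact (hP.measurable_s t).mono (ℱ.le _) le_rfl
    · exact (hP.measurable_a t).mono (ℱ.le _) le_rfl
    · exact (hP.measurable_s (t + 1)).mono (ℱ.le _) le_rfl
  have hind : Measurable fun ω =>
      if fstar.dens (s t ω) (a t ω) (s (t + 1) ω) = 0 then (1 : ℝ≥0∞) else 0 := hφ.comp hcomp
  rw [lintegral_eq_zero_iff hind] at h
  filter_upwards [h] with ω hω
  by_contra hcon
  simp [nonpos_iff_eq_zero.1 (not_lt.1 hcon)] at hω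

end Interaction

/-! ### Value functions -/

section Value

theorem le_greedyValue {S A : Type*} [Finite A] (Q : S → A → ℝ) (s : S) (b : A) :
    Q s b ≤ greedyValue Q s :=
  le_ciSup (Set.finite_range _).bddAbove b

theorem greedyValue_eq {S A : Type*} [Finite A] [Nonempty A] {Q : S → A → ℝ} {s : S} {b : A}
    (h : ∀ b', Q s b' ≤ Q s b) : greedyValue Q s = Q s b :=
  le_antisymm (ciSup_le h) (le_greedyValue Q s b)

theorem abs_sub_le_spanOf {S : Type*} {V : S → ℝ} {K : ℝ} (hV : ∀ s, |V s| ≤ K) (x y : S) :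
    |V x - V y| ≤ spanOf V := by
  refine le_ciSup (f := fun z : S × S => |V z.1 - V z.2|) ⟨K + K, ?_⟩ (x, y)
  rintro _ ⟨z, rfl⟩
  exact (abs_sub _ _).trans (add_le_add (hV _) (hV _))

theorem spanOf_nonneg {S : Type*} (V : S → ℝ) : 0 ≤ spanOf V :=
  Real.iSup_nonneg fun _ => abs_nonneg _

variable {S : Type*} [MeasurableSpace S] {A : Type*} [MeasurableSpace A]
  {ν : Kernel (S × A) S}

theorem Hypothesis.measurable_V [Countable A] (f : Hypothesis ν) : Measurable f.V := by
  refine Measurable.iSup fun b => ?_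
  exact f.bellman.measurable_Q.comp (measurable_id.prodMk measurable_const)

theorem Hypothesis.exists_abs_V_le [Finite A] [Nonempty A] (f : Hypothesis ν) :
    ∃ K : ℝ, ∀ s, |f.V s| ≤ K := by
  obtain ⟨K, hK⟩ := f.bellman.bounded_Q
  refine ⟨K, fun s => ?_⟩
  obtain ⟨b, hb⟩ := Finite.exists_max (f.Q s)
  rw [Hypothesis.V, greedyValue_eq hb]
  exact hK s b

/-- Hoeffding's lemma for a function of oscillation at most `c`. -/
theorem lintegral_exp_sub_le_one {P : Measure S} [IsProbabilityMeasure P] {V : S → ℝ}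
    (hV : Measurable V) {K c : ℝ} (hK : ∀ s, |V s| ≤ K) (hc : ∀ x y, |V x - V y| ≤ c) (l : ℝ) :
    ∫⁻ y, ENNReal.ofReal (Real.exp (l * (∫ z, V z ∂P - V y) - l ^ 2 * c ^ 2 / 8)) ∂P ≤ 1 := by
  have hne : Nonempty S := by
    by_contra h
    rw [not_nonempty_iff] at h
    have h1 := measure_univ (μ := P)
    simp [Set.univ_eq_empty_iff.2 h] at h1
  have hbb : BddBelow (Set.range V) := ⟨-K, by rintro _ ⟨x, rfl⟩; exact (abs_le.1 (hK x)).1⟩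
  have hba : BddAbove (Set.range V) := ⟨K, by rintro _ ⟨x, rfl⟩; exact (abs_le.1 (hK x)).2⟩
  have hcc : (⨆ x, V x) - ⨅ x, V x ≤ c := by
    rw [sub_le_iff_le_add]
    refine ciSup_le fun x => ?_
    rw [← sub_le_iff_le_add']
    refine le_ciInf fun y => ?_
    linarith [(abs_le.1 (hc x y)).2]
  have h0 : 0 ≤ (⨆ x, V x) - ⨅ x, V x :=
    sub_nonneg.2 ((ciInf_le hbb hne.some).trans (le_ciSup hba hne.some))
  have hsub := hasSubgaussianMGF_of_mem_Icc (μ := P) (X := V) hV.aemeasurable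
    (ae_of_all _ fun x => ⟨ciInf_le hbb x, le_ciSup hba x⟩)
  have hm := hsub.mgf_le (-l)
  have hi := hsub.integrable_exp_mul (-l)
  have e : ∀ y, Real.exp (l * (∫ z, V z ∂P - V y) - l ^ 2 * c ^ 2 / 8) =
      Real.exp (-(l ^ 2 * c ^ 2 / 8)) * Real.exp (-l * (V y - ∫ z, V z ∂P)) := by
    intro y
    rw [← Real.exp_add]
    ring_nf
  simp_rw [e]
  rw [← ofReal_integral_eq_lintegral_ofReal (hi.const_mul _)
    (ae_of_all _ fun y => by positivity), ← ENNReal.ofReal_one]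
  refine ENNReal.ofReal_le_ofReal ?_
  rw [integral_const_mul]
  refine (mul_le_mul_of_nonneg_left hm (Real.exp_pos _).le).trans ?_
  rw [← Real.exp_add, Real.exp_le_one_iff]
  push_cast
  rw [Real.norm_of_nonneg h0]
  have hsq : ((⨆ x, V x) - ⨅ x, V x) ^ 2 ≤ c ^ 2 := pow_le_pow_left₀ h0 hcc 2
  nlinarith [mul_le_mul_of_nonneg_left hsq (sq_nonneg l)]

end Value

/-! ### Trajectories of MLE-LOOP -/

section Path

variable {S : Type*} [MeasurableSpace S] {A : Type*} [MeasurableSpace A] {ν : Kernel (S × A) S}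
  {M : AMDP S A} {H : Set (Hypothesis ν)} {β : ℝ} {T : ℕ} {s : ℕ → S} {a : ℕ → A}
  {f g : ℕ → Hypothesis ν} {fstar : Hypothesis ν}

theorem IsMLELoopPath.mem (hp : IsMLELoopPath H β T s a f g) : ∀ t ∈ Finset.Icc 1 T, f t ∈ H := by
  intro t
  induction t with
  | zero => intro h; simp at h
  | succ t ih =>
    intro ht
    by_cases hsw : t + 1 = 1 ∨ 3 * √(β * (t + 1 : ℕ)) ≤ upsilon s a f g (t + 1 - 1)
    · exact (hp.switch _ ht hsw).1.1
    · rw [hp.stay _ ht hsw]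
      refine ih (Finset.mem_Icc.2 ⟨?_, ?_⟩)
      · rcases Nat.eq_zero_or_pos t with rfl | h
        · simp at hsw
        · exact h
      · rw [Finset.mem_Icc] at ht; omega

/-- The statistical guarantee of maximum likelihood along one trajectory: the true model is never
rejected, and hypotheses whose log-likelihood is within `β` of that of the true model are close to
it on the data. The factor `5 / 4` leaves a margin below the switching threshold `3 √(β t)` after
two hypotheses have been compared with the true model. -/
structure LikelihoodControl (H : Set (Hypothesis ν)) (fstar : Hypothesis ν) (β : ℝ) (T : ℕ)
    (s : ℕ → S) (a : ℕ → A) : Prop where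
  optimism : ∀ t ∈ Finset.Icc 1 T, fstar ∈ confidenceSet H β s a (t - 1)
  close : ∀ t ∈ Finset.Icc 1 T, ∀ h ∈ H,
    negLogLik s a (t - 1) h ≤ negLogLik s a (t - 1) fstar + (β : EReal) →
    ∑ i ∈ Finset.Icc 1 (t - 1), tvDist h fstar (s i) (a i) ≤ 1 / 2 + 5 / 4 * √(β * t)

theorem LikelihoodControl.close_of_mem (hc : LikelihoodControl H fstar β T s a)
    {t : ℕ} (ht : t ∈ Finset.Icc 1 T) {h : Hypothesis ν} (hh : h ∈ confidenceSet H β s a (t - 1)) :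
    ∑ i ∈ Finset.Icc 1 (t - 1), tvDist h fstar (s i) (a i) ≤ 1 / 2 + 5 / 4 * √(β * t) := by
  refine hc.close t ht h hh.1 (hh.2.trans ?_)
  exact add_le_add_left (iInf₂_le fstar (hc.optimism t ht).1) _

/-- The estimator `g_t` is fitted without the transition at time `t`, whose total variation is
bounded by one. -/
theorem IsMLELoopPath.close_mle (hp : IsMLELoopPath H β T s a f g)
    (hc : LikelihoodControl H fstar β T s a) (hβ : 0 ≤ β) {t : ℕ} (ht : t ∈ Finset.Icc 1 T) :
    ∑ i ∈ Finset.Icc 1 t, tvDist (g t) fstar (s i) (a i) ≤ 3 / 2 + 5 / 4 * √(β * t) := by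
  obtain ⟨hg, hmin⟩ := hp.mle t ht
  have h1 := hc.close t ht (g t) hg ((hmin fstar (hc.optimism t ht).1).trans
    (le_add_of_nonneg_right (EReal.coe_nonneg.2 hβ)))
  obtain ⟨n, rfl⟩ : ∃ n, t = n + 1 := ⟨t - 1, by rw [Finset.mem_Icc] at ht; omega⟩
  rw [Finset.sum_Icc_succ_top (Nat.le_add_left 1 n)]
  rw [Nat.add_sub_cancel] at h1
  linarith [tvDist_le_one (g (n + 1)) fstar (s (n + 1)) (a (n + 1))]

theorem ten_le_sqrt {t : ℕ} (ht : 1 ≤ t) (hβ : 100 ≤ β) : 10 ≤ √(β * t) := by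
  refine Real.le_sqrt_of_sq_le ?_
  have : (1 : ℝ) ≤ t := by exact_mod_cast ht
  nlinarith

/-- The executed hypotheses are close to the true model on the past data: at a switch because they
lie in the confidence set, otherwise because the update statistic stayed below its threshold. -/
theorem IsMLELoopPath.sum_tvDist_le (hp : IsMLELoopPath H β T s a f g)
    (hc : LikelihoodControl H fstar β T s a) (hβ : 100 ≤ β) {t : ℕ} (ht : t ∈ Finset.Icc 1 T) :
    ∑ i ∈ Finset.Icc 1 (t - 1), tvDist (f t) fstar (s i) (a i) ≤ 5 * √(β * t) := by
  have h10 := ten_le_sqrt (Finset.mem_Icc.1 ht).1 hβ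
  by_cases hsw : t = 1 ∨ 3 * √(β * t) ≤ upsilon s a f g (t - 1)
  · have := hc.close_of_mem ht (hp.switch _ ht hsw).1
    linarith
  · have hst := hp.stay _ ht hsw
    push Not at hsw
    have ht' : t - 1 ∈ Finset.Icc 1 T := by rw [Finset.mem_Icc] at *; omega
    have h1 := hp.close_mle hc (by linarith) ht'
    have hmono : √(β * (t - 1 : ℕ)) ≤ √(β * t) :=
      Real.sqrt_le_sqrt (mul_le_mul_of_nonneg_left (by exact_mod_cast Nat.sub_le t 1)
        (by linarith))
    have h2 : ∑ i ∈ Finset.Icc 1 (t - 1), tvDist (f t) fstar (s i) (a i) ≤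
        upsilon s a f g (t - 1) +
          ∑ i ∈ Finset.Icc 1 (t - 1), tvDist (g (t - 1)) fstar (s i) (a i) := by
      rw [upsilon, ← Finset.sum_add_distrib, hst]
      exact Finset.sum_le_sum fun i _ => tvDist_triangle _ _ _ _ _
    linarith [hsw.2]

/-- A hypothesis chosen at time `τ` and abandoned at time `t` accumulates a total variation of at
least one over its epoch. -/
theorem IsMLELoopPath.one_le_sum_tvDist (hp : IsMLELoopPath H β T s a f g)
    (hc : LikelihoodControl H fstar β T s a) (hβ : 100 ≤ β) {τ t : ℕ} (hτ : 1 ≤ τ) (hτt : τ ≤ t)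
    (ht : t + 1 ≤ T) (hconst : ∀ i ∈ Finset.Icc τ t, f i = f t)
    (hmem : f t ∈ confidenceSet H β s a (τ - 1))
    (hsw : 3 * √(β * (t + 1 : ℕ)) ≤ upsilon s a f g t) :
    1 ≤ ∑ i ∈ Finset.Icc τ t, tvDist (f i) fstar (s i) (a i) := by
  have h10 := ten_le_sqrt (t := t + 1) (by omega) hβ
  have hmono : ∀ k ≤ t + 1, √(β * (k : ℕ)) ≤ √(β * (t + 1 : ℕ)) := fun k hk =>
    Real.sqrt_le_sqrt (mul_le_mul_of_nonneg_left (by exact_mod_cast hk) (by linarith))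
  have h1 := hp.close_mle hc (by linarith) (t := t) (Finset.mem_Icc.2 ⟨by omega, by omega⟩)
  have h2 := hc.close_of_mem (t := τ) (Finset.mem_Icc.2 ⟨hτ, by omega⟩) hmem
  have h3 : upsilon s a f g t ≤ ∑ i ∈ Finset.Icc 1 t, tvDist (f t) fstar (s i) (a i) +
      ∑ i ∈ Finset.Icc 1 t, tvDist (g t) fstar (s i) (a i) := by
    rw [upsilon, ← Finset.sum_add_distrib]
    refine Finset.sum_le_sum fun i _ => ?_
    rw [tvDist_comm (g t)]
    exact tvDist_triangle _ _ _ _ _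
  have h4 : ∑ i ∈ Finset.Icc 1 t, tvDist (f t) fstar (s i) (a i) =
      ∑ i ∈ Finset.Icc 1 (τ - 1), tvDist (f t) fstar (s i) (a i) +
      ∑ i ∈ Finset.Icc τ t, tvDist (f i) fstar (s i) (a i) := by
    have e : ∑ i ∈ Finset.Icc τ t, tvDist (f i) fstar (s i) (a i) =
        ∑ i ∈ Finset.Icc τ t, tvDist (f t) fstar (s i) (a i) :=
      Finset.sum_congr rfl fun i hi => by rw [hconst i hi]
    rw [e, ← Finset.sum_union]
    · congr 1
      ext i
      simp only [Finset.mem_Icc, Finset.mem_union]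
      omega
    · rw [Finset.disjoint_left]
      intro i
      simp only [Finset.mem_Icc]
      omega
  linarith [hmono t (by omega), hmono τ (by omega)]

variable {sp : ℝ}

/-- Telescoping over epochs. Within an epoch the values telescope; each switch costs at most the
span, which is charged to the total variation accumulated over the epoch that it closes. Here `τ`
is the beginning of the current epoch. -/
theorem IsMLELoopPath.exists_epoch (hp : IsMLELoopPath H β T s a f g)
    (hc : LikelihoodControl H fstar β T s a) (hβ : 100 ≤ β) (hsp : 0 ≤ sp)
    (hV : ∀ h ∈ H, ∀ x y, h.V x - h.V y ≤ sp) {t : ℕ} (ht : t ∈ Finset.Icc 1 T) :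
    ∃ τ, 1 ≤ τ ∧ τ ≤ t ∧ (∀ i ∈ Finset.Icc τ t, f i = f t) ∧
      f t ∈ confidenceSet H β s a (τ - 1) ∧ fstar.J ≤ (f t).J ∧
      ∑ i ∈ Finset.Icc 1 t, ((f i).V (s (i + 1)) - (f i).V (s i)) ≤
        sp * ∑ i ∈ Finset.Icc 1 (τ - 1), tvDist (f i) fstar (s i) (a i) +
          ((f t).V (s (t + 1)) - (f t).V (s τ)) := by
  induction t with
  | zero => simp at ht
  | succ t ih =>
    by_cases hsw : t + 1 = 1 ∨ 3 * √(β * (t + 1 : ℕ)) ≤ upsilon s a f g (t + 1 - 1)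
    · obtain ⟨hmem, hJ⟩ := hp.switch _ ht hsw
      refine ⟨t + 1, by omega, le_rfl, fun i hi => ?_, hmem, hJ _ (hc.optimism _ ht), ?_⟩
      · rw [Finset.Icc_self, Finset.mem_singleton] at hi
        rw [hi]
      · rw [Finset.sum_Icc_succ_top (Nat.le_add_left 1 t)]
        refine add_le_add_left ?_ _
        rw [Nat.add_sub_cancel]
        rcases Nat.eq_zero_or_pos t with rfl | h0
        · simp
        have ht' : t ∈ Finset.Icc 1 T := by rw [Finset.mem_Icc] at *; omega
        obtain ⟨τ, h1, h2, h3, h4, -, h6⟩ := ih ht'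
        have hsw' := hsw.resolve_left (by omega)
        have hone := hp.one_le_sum_tvDist hc hβ h1 h2 (Finset.mem_Icc.1 ht).2 h3 h4 hsw'
        have hsplit : ∑ i ∈ Finset.Icc 1 t, tvDist (f i) fstar (s i) (a i) =
            ∑ i ∈ Finset.Icc 1 (τ - 1), tvDist (f i) fstar (s i) (a i) +
            ∑ i ∈ Finset.Icc τ t, tvDist (f i) fstar (s i) (a i) := by
          rw [← Finset.sum_union]
          · congr 1
            ext i
            simp only [Finset.mem_Icc, Finset.mem_union]
            omega
          · rw [Finset.disjoint_left]
            intro i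
            simp only [Finset.mem_Icc]
            omega
        have hv := hV _ (hp.mem t ht') (s (t + 1)) (s τ)
        have := mul_le_mul_of_nonneg_left hone hsp
        rw [hsplit, mul_add]
        linarith
    · have hst := hp.stay _ ht hsw
      rw [Nat.add_sub_cancel] at hst
      push Not at hsw
      have ht' : t ∈ Finset.Icc 1 T := by rw [Finset.mem_Icc] at *; omega
      obtain ⟨τ, h1, h2, h3, h4, h5, h6⟩ := ih ht'
      refine ⟨τ, h1, by omega, fun i hi => ?_, hst ▸ h4, hst ▸ h5, ?_⟩
      · rw [Finset.mem_Icc] at hi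
        rcases Nat.lt_or_ge t i with h | h
        · rw [show i = t + 1 by omega]
        · rw [h3 i (Finset.mem_Icc.2 ⟨hi.1, h⟩), hst]
      · rw [Finset.sum_Icc_succ_top (Nat.le_add_left 1 t), hst]
        linarith

theorem IsMLELoopPath.sum_value_le (hp : IsMLELoopPath H β T s a f g)
    (hc : LikelihoodControl H fstar β T s a) (hβ : 100 ≤ β) (hsp : 0 ≤ sp) (hT : 1 ≤ T)
    (hV : ∀ h ∈ H, ∀ x y, h.V x - h.V y ≤ sp) :
    ∑ i ∈ Finset.Icc 1 T, ((f i).V (s (i + 1)) - (f i).V (s i)) ≤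
      sp * (∑ i ∈ Finset.Icc 1 T, tvDist (f i) fstar (s i) (a i) + 1) := by
  have hTm : T ∈ Finset.Icc 1 T := Finset.mem_Icc.2 ⟨hT, le_rfl⟩
  obtain ⟨τ, h1, h2, -, -, -, h6⟩ := hp.exists_epoch hc hβ hsp hV hTm
  have hle : ∑ i ∈ Finset.Icc 1 (τ - 1), tvDist (f i) fstar (s i) (a i) ≤
      ∑ i ∈ Finset.Icc 1 T, tvDist (f i) fstar (s i) (a i) :=
    Finset.sum_le_sum_of_subset_of_nonneg (Finset.Icc_subset_Icc_right (by omega))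
      fun _ _ _ => tvDist_nonneg _ _ _ _
  have hv := hV _ (hp.mem T hTm) (s (T + 1)) (s τ)
  have := mul_le_mul_of_nonneg_left hle hsp
  rw [mul_add]
  linarith

/-- Regret decomposition by optimism and the Bellman equation. -/
theorem IsMLELoopPath.regret_le [Finite A] [Nonempty A] (hp : IsMLELoopPath H β T s a f g)
    (hc : LikelihoodControl H fstar β T s a) (hβ : 100 ≤ β) (hsp : 0 ≤ sp) (hT : 1 ≤ T)
    (hV : ∀ h ∈ H, ∀ x y, h.V x - h.V y ≤ sp) :
    regret M fstar.J T s a ≤ ∑ t ∈ Finset.Icc 1 T, bellmanError M (f t) (s t) (a t) +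
      ∑ t ∈ Finset.Icc 1 T, (∫ y, (f t).V y ∂(M.P (s t, a t)) - (f t).V (s (t + 1))) +
      sp * (∑ t ∈ Finset.Icc 1 T, tvDist (f t) fstar (s t) (a t) + 1) := by
  refine le_trans ?_ (add_le_add_right (hp.sum_value_le hc hβ hsp hT hV) _)
  rw [regret, ← Finset.sum_add_distrib, ← Finset.sum_add_distrib]
  refine Finset.sum_le_sum fun t ht => ?_
  obtain ⟨-, -, -, -, -, hJ, -⟩ := hp.exists_epoch hc hβ hsp hV ht
  have hg : (f t).V (s t) = (f t).Q (s t) (a t) := greedyValue_eq (hp.greedy t ht)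
  rw [hg, bellmanError]
  linarith

/-- Likelihood ratio control for brackets of the whole class yields `LikelihoodControl`. The true
model is kept because the brackets' affinities exceed one by `1 / (2 T)` at most, so that no
hypothesis has a likelihood ratio above `exp (2 L + 1)`. Conversely a likelihood ratio above
`exp (-β)` forces `∑ (1 - Z) ≤ β / 2 + L`, which bounds the total variation. -/
theorem likelihoodControl_of_ratio (hstar : fstar ∈ H) (hT : 1 ≤ T)
    (hpos : ∀ t ∈ Finset.Icc 1 T, 0 < fstar.dens (s t) (a t) (s (t + 1))) {L : ℝ} (hL : 1 ≤ L)
    (hβ : 100 * L ≤ β)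
    (hU : ∀ h ∈ H, ∃ u, Brackets h (1 / (T : ℝ)) u ∧ ∀ n < T,
      ∏ t ∈ Finset.Icc 1 n, ratioFactor fstar u (s t) (a t) (s (t + 1)) < Real.exp L) :
    LikelihoodControl H fstar β T s a := by
  have hT0 : (0 : ℝ) < T := by exact_mod_cast hT
  -- `exp (∑ (1 - Z)) √(P_h / P_{f*}) < exp L`, with the ratio of likelihoods written as `R ^ 2`
  have key : ∀ n < T, 0 < likelihood s a n fstar ∧ ∀ h ∈ H, ∃ u, Brackets h (1 / (T : ℝ)) u ∧
      ∃ R : ℝ, 0 ≤ R ∧ (likelihood s a n h : ℝ) = R ^ 2 * likelihood s a n fstar ∧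
        R * Real.exp (∑ i ∈ Finset.Icc 1 n, (1 - affinity fstar u (s i) (a i))) <
          Real.exp L := by
    intro n hn
    have hsub : ∀ i ∈ Finset.Icc 1 n, i ∈ Finset.Icc 1 T := fun i hi => by
      rw [Finset.mem_Icc] at *; omega
    refine ⟨Finset.prod_pos fun i hi => hpos i (hsub i hi), fun h hh => ?_⟩
    obtain ⟨u, hu, hlt⟩ := hU h hh
    refine ⟨u, hu, ∏ i ∈ Finset.Icc 1 n,
      √((h.dens (s i) (a i) (s (i + 1)) : ℝ) / fstar.dens (s i) (a i) (s (i + 1))),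
      Finset.prod_nonneg fun _ _ => Real.sqrt_nonneg _, ?_, ?_⟩
    · rw [likelihood, likelihood, NNReal.coe_prod, NNReal.coe_prod, ← Finset.prod_pow,
        ← Finset.prod_mul_distrib]
      refine Finset.prod_congr rfl fun i hi => ?_
      rw [Real.sq_sqrt (by positivity), div_mul_cancel₀]
      exact (NNReal.coe_pos.2 (hpos i (hsub i hi))).ne'
    · refine lt_of_le_of_lt ?_ (hlt n hn)
      rw [Real.exp_sum, ← Finset.prod_mul_distrib]
      refine Finset.prod_le_prod (fun _ _ => by positivity) fun i _ => ?_
      refine mul_le_mul_of_nonneg_right (Real.sqrt_le_sqrt ?_) (Real.exp_pos _).le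
      exact div_le_div_of_nonneg_right (NNReal.coe_le_coe.2 (hu.le _ _ _)) (NNReal.coe_nonneg _)
  have hidx : ∀ t ∈ Finset.Icc 1 T, t - 1 < T ∧ ((t - 1 : ℕ) : ℝ) * (1 / T) ≤ 1 ∧
      ((t - 1 : ℕ) : ℝ) + 1 = t := by
    intro t ht
    obtain ⟨h1, h2⟩ := Finset.mem_Icc.1 ht
    refine ⟨by omega, ?_, by exact_mod_cast Nat.sub_add_cancel h1⟩
    rw [mul_one_div, div_le_one hT0]
    exact_mod_cast (by omega : t - 1 ≤ T)
  refine ⟨fun t ht => ⟨hstar, ?_⟩, fun t ht h hh hle => ?_⟩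
  · obtain ⟨hn, hρ, -⟩ := hidx t ht
    obtain ⟨hp0, hk⟩ := key _ hn
    have hall : ∀ h ∈ H, negLogLik s a (t - 1) fstar ≤ negLogLik s a (t - 1) h + (β : EReal) := by
      intro h hh
      rw [negLogLik_eq, negLogLik_eq, le_neg_log_add_iff hp0]
      obtain ⟨u, hu, R, hR, heq, hlt⟩ := hk h hh
      rw [heq]
      refine mul_le_mul_of_nonneg_right ?_ (NNReal.coe_nonneg _)
      have hsum : -(1 / 2 : ℝ) ≤
          ∑ i ∈ Finset.Icc 1 (t - 1), (1 - affinity fstar u (s i) (a i)) := by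
        have : ∑ i ∈ Finset.Icc 1 (t - 1), (-((1 / (T : ℝ)) / 2)) ≤
            ∑ i ∈ Finset.Icc 1 (t - 1), (1 - affinity fstar u (s i) (a i)) :=
          Finset.sum_le_sum fun i _ => by
            linarith [hu.affinity_le (by positivity) fstar (s i) (a i)]
        rw [Finset.sum_const, Nat.card_Icc, Nat.add_sub_cancel, nsmul_eq_mul] at this
        linarith
      have hR2 : R ≤ Real.exp (L + 1 / 2) := by
        have h1 : R * Real.exp (-(1 / 2)) ≤ Real.exp L :=
          (mul_le_mul_of_nonneg_left (Real.exp_le_exp.2 hsum) hR).trans hlt.le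
        rw [Real.exp_neg, mul_inv_le_iff₀ (Real.exp_pos _)] at h1
        rwa [Real.exp_add]
      calc R ^ 2 ≤ Real.exp (L + 1 / 2) ^ 2 := pow_le_pow_left₀ hR hR2 2
        _ = Real.exp (2 * L + 1) := by rw [← Real.exp_nat_mul]; push_cast; ring_nf
        _ ≤ Real.exp β := Real.exp_le_exp.2 (by linarith)
    have hinf : ∀ h ∈ H, negLogLik s a (t - 1) fstar - (β : EReal) ≤ negLogLik s a (t - 1) h :=
      fun h hh => EReal.sub_le_of_le_add (hall h hh)
    have := le_iInf₂ hinf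
    exact (EReal.sub_le_iff_le_add (Or.inl (EReal.coe_ne_bot _))
      (Or.inl (EReal.coe_ne_top _))).1 this
  · obtain ⟨hn, hρ, htn⟩ := hidx t ht
    obtain ⟨hp0, hk⟩ := key _ hn
    obtain ⟨u, hu, R, hR, heq, hlt⟩ := hk h hh
    rw [negLogLik_eq, negLogLik_eq, neg_log_le_neg_log_add_iff hp0, heq, ← mul_assoc] at hle
    have hp0' : (0 : ℝ) < likelihood s a (t - 1) fstar := NNReal.coe_pos.2 hp0
    have h1 : 1 ≤ Real.exp β * R ^ 2 := by
      by_contra hcon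
      push Not at hcon
      nlinarith
    have hR2 : Real.exp (-(β / 2)) ≤ R := by
      refine (sq_le_sq₀ (Real.exp_pos _).le hR).1 ?_
      rw [← Real.exp_nat_mul]
      push_cast
      rw [show 2 * -(β / 2) = -β by ring, Real.exp_neg, inv_le_iff_one_le_mul₀ (Real.exp_pos _)]
      linarith
    have hsum : ∑ i ∈ Finset.Icc 1 (t - 1), (1 - affinity fstar u (s i) (a i)) < β / 2 + L := by
      have h2 := (mul_le_mul_of_nonneg_right hR2 (Real.exp_pos _).le).trans_lt hlt
      rw [← Real.exp_add, Real.exp_lt_exp] at h2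
      linarith
    set Z := ∑ i ∈ Finset.Icc 1 (t - 1), (1 - affinity fstar u (s i) (a i)) with hZ
    have ht0 : (0 : ℝ) < t := by exact_mod_cast (Finset.mem_Icc.1 ht).1
    have hβ0 : 0 < β := by linarith
    have hst : 0 < √(t : ℝ) := Real.sqrt_pos.2 ht0
    have hsb : 0 < √β := Real.sqrt_pos.2 hβ0
    -- the weight that balances the two terms of the linearised Cauchy-Schwarz inequality
    set x : ℝ := 8 * √(t : ℝ) / (5 * √β) with hx
    have hx0 : 0 < x := by positivity
    have hbound : ∑ i ∈ Finset.Icc 1 (t - 1), tvDist h fstar (s i) (a i) ≤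
        ∑ i ∈ Finset.Icc 1 (t - 1), (((1 / (T : ℝ)) / 2 + (x * (1 / (T : ℝ)) +
          2 * (2 + 1 / (T : ℝ)) / x) / 4) + x / 2 * (1 - affinity fstar u (s i) (a i))) :=
      Finset.sum_le_sum fun i _ => by
        have := hu.tvDist_le (by positivity) fstar (s i) (a i) hx0
        linarith
    rw [Finset.sum_add_distrib, ← Finset.mul_sum, ← hZ, Finset.sum_const, Nat.card_Icc,
      Nat.add_sub_cancel, nsmul_eq_mul] at hbound
    set n : ℝ := ((t - 1 : ℕ) : ℝ) with hnn
    set ρ : ℝ := 1 / (T : ℝ) with hρρ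
    have e1 : n * (ρ / 2 + (x * ρ + 2 * (2 + ρ) / x) / 4) + x / 2 * Z =
        n * ρ / 2 + x * (n * ρ + 2 * Z) / 4 + (n + n * ρ / 2) * (1 / x) := by
      field_simp
      ring
    rw [e1] at hbound
    have hb1 : x * (n * ρ + 2 * Z) ≤ x * (25 / 16 * β) :=
      mul_le_mul_of_nonneg_left (by linarith) hx0.le
    have hb2 : (n + n * ρ / 2) * (1 / x) ≤ t * (1 / x) :=
      mul_le_mul_of_nonneg_right (by linarith) (by positivity)
    have e2 : x * (25 / 16 * β) = 5 / 2 * (√(t : ℝ) * √β) := by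
      rw [hx]
      nth_rewrite 2 [← Real.mul_self_sqrt hβ0.le]
      field_simp
      ring
    have e3 : (t : ℝ) * (1 / x) = 5 / 8 * (√(t : ℝ) * √β) := by
      rw [hx]
      nth_rewrite 1 [← Real.mul_self_sqrt ht0.le]
      field_simp
    rw [Real.sqrt_mul hβ0.le]
    nlinarith

end Path

/-! ### The martingale term -/

section Martingale

variable {S : Type*} [MeasurableSpace S] {A : Type*} [MeasurableSpace A] {ν : Kernel (S × A) S}
  {M : AMDP S A} {H : Set (Hypothesis ν)} {β : ℝ} {T : ℕ} {s₁ : S}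
  {Ω : Type*} [mΩ : MeasurableSpace Ω] {μ : Measure Ω}
  {ℱ : Filtration ℕ mΩ} {s : ℕ → Ω → S} {a : ℕ → Ω → A} {f g : ℕ → Ω → Hypothesis ν}

/-- Azuma-Hoeffding inequality for the values of the executed hypotheses at the next state, from
the supermartingale with factors `exp (l D_t - l² sp² / 8)`. -/
theorem IsMLELoopProcess.measure_martingale_le [IsProbabilityMeasure μ] [Finite A] [Nonempty A]
    (hP : IsMLELoopProcess M H β T s₁ μ ℱ s a f g) {sp : ℝ}
    (hH : ∀ h ∈ H, spanOf h.V ≤ sp) {l : ℝ} (hl : 0 < l) (L : ℝ) :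
    μ {ω | L / l + l * T * sp ^ 2 / 8 ≤ ∑ t ∈ Finset.Icc 1 T,
      (∫ y, (f t ω).V y ∂(M.P (s t ω, a t ω)) - (f t ω).V (s (t + 1) ω))} ≤
      ENNReal.ofReal (Real.exp (-L)) := by
  have := M.markov
  have hmain := hP.measure_le_prod_le (φ := fun t z => ENNReal.ofReal (Real.exp
    (l * (∫ y, (f t z.1).V y ∂(M.P (s t z.1, a t z.1)) - (f t z.1).V z.2)
      - l ^ 2 * sp ^ 2 / 8))) (fun t ht => ?_) (fun t ht => ?_) le_rfl (Real.exp_pos L)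
  · rw [one_div, ← Real.exp_neg] at hmain
    refine (measure_mono fun ω hω => ?_).trans hmain
    change L / l + l * T * sp ^ 2 / 8 ≤ _ at hω
    show ENNReal.ofReal (Real.exp L) ≤ _
    rw [← ENNReal.ofReal_prod_of_nonneg fun _ _ => (Real.exp_pos _).le, ← Real.exp_sum]
    refine ENNReal.ofReal_le_ofReal (Real.exp_le_exp.2 ?_)
    rw [Finset.sum_sub_distrib, ← Finset.mul_sum, Finset.sum_const, Nat.card_Icc,
      Nat.add_sub_cancel, nsmul_eq_mul]
    have h1 := mul_le_mul_of_nonneg_left hω hl.le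
    have h2 : l * (L / l + l * T * sp ^ 2 / 8) = L + T * (l ^ 2 * sp ^ 2 / 8) := by
      field_simp
    linarith
  · have hv := hP.measurable_V t ht
    have hI : Measurable[ℱ t] fun ω => ∫ y, (f t ω).V y ∂(M.P (s t ω, a t ω)) :=
      @measurable_integral_kernel_comp Ω (S × A) S (ℱ t) _ _ _
        ((hP.measurable_s t).prodMk (hP.measurable_a t)) M.P _ _ hv
    have hc : @Measurable (Ω × S) (ℝ × ℝ) ((ℱ t).prod inferInstance) _
        (fun z => (∫ y, (f t z.1).V y ∂(M.P (s t z.1, a t z.1)), (f t z.1).V z.2)) :=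
      @measurable_comp_fst_prodMk Ω S (ℱ t) _ _ hI _ hv
    have he : Measurable fun w : ℝ × ℝ =>
        ENNReal.ofReal (Real.exp (l * (w.1 - w.2) - l ^ 2 * sp ^ 2 / 8)) := by fun_prop
    exact he.comp hc
  · filter_upwards [hP.path] with ω hω
    obtain ⟨K, hK⟩ := (f t ω).exists_abs_V_le
    exact lintegral_exp_sub_le_one (f t ω).measurable_V hK
      (fun x y => (abs_sub_le_spanOf hK x y).trans (hH _ (hω.mem t ht))) l

/-- The Azuma-Hoeffding inequality at confidence `exp (-L)`, including the degenerate case of zero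
span, where the martingale vanishes. -/
theorem IsMLELoopProcess.measure_martingale_gt_le [IsProbabilityMeasure μ] [Finite A] [Nonempty A]
    (hP : IsMLELoopProcess M H β T s₁ μ ℱ s a f g) {sp : ℝ} (hsp : 0 ≤ sp)
    (hH : ∀ h ∈ H, spanOf h.V ≤ sp) (hT : 1 ≤ T) {L : ℝ} (hL : 0 < L) :
    μ {ω | 2 * sp * (√L * √T) < ∑ t ∈ Finset.Icc 1 T,
      (∫ y, (f t ω).V y ∂(M.P (s t ω, a t ω)) - (f t ω).V (s (t + 1) ω))} ≤
      ENNReal.ofReal (Real.exp (-L)) := by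
  have hT0 : (0 : ℝ) < T := by exact_mod_cast hT
  have hsT : 0 < √(T : ℝ) := Real.sqrt_pos.2 hT0
  have hsL : 0 < √L := Real.sqrt_pos.2 hL
  rcases hsp.eq_or_lt with rfl | hsp0
  · have := M.markov
    refine (measure_eq_zero_iff_ae_notMem.2 ?_).trans_le (zero_le)
    filter_upwards [hP.path] with ω hω
    rw [not_lt, mul_zero, zero_mul]
    refine Finset.sum_nonpos fun t ht => ?_
    obtain ⟨K, hK⟩ := (f t ω).exists_abs_V_le
    have hconst : ∀ y, (f t ω).V y = (f t ω).V (s (t + 1) ω) := fun y => by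
      have h1 := (abs_sub_le_spanOf hK y (s (t + 1) ω)).trans (hH _ (hω.mem t ht))
      exact sub_eq_zero.1 (abs_nonpos_iff.1 h1)
    simp_rw [hconst]
    simp
  · -- this `l` balances `L / l` against `l T sp²`
    refine (measure_mono fun ω hω => ?_).trans (hP.measure_martingale_le hH
      (l := √L / (sp * √T)) (by positivity) L)
    change 2 * sp * (√L * √T) < _ at hω
    refine le_trans (le_of_eq_of_le ?_ (by nlinarith [mul_pos hsp0 (mul_pos hsL hsT)] :
      9 / 8 * (sp * (√L * √T)) ≤ 2 * sp * (√L * √T))) hω.le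
    nth_rewrite 1 [← Real.mul_self_sqrt hL.le]
    nth_rewrite 3 [← Real.mul_self_sqrt hT0.le]
    field_simp
    ring

end Martingale

/-! ### Combining the estimates -/

/-- A class with bracketing number `B` is covered by at most `B` brackets; members of a minimal
bracketing set that bracket no hypothesis, and may have infinite mass, are left out. -/
theorem exists_finset_brackets {S : Type*} [MeasurableSpace S] {A : Type*} [MeasurableSpace A]
    {ν : Kernel (S × A) S} {H : Set (Hypothesis ν)} {ρ : ℝ} {B : ℕ}
    (hB : bracketingNumber H ρ = B) :
    ∃ U : Finset (S → A → S → ℝ≥0), U.card ≤ B ∧ (∀ u ∈ U, ∃ h : Hypothesis ν, Brackets h ρ u) ∧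
      ∀ h ∈ H, ∃ u ∈ U, Brackets h ρ u := by
  classical
  obtain ⟨U, hU, hcard⟩ : ∃ U, IsBracket H ρ U ∧ U.encard ≤ B := by
    by_contra hcon
    push Not at hcon
    have : ((B : ℕ∞) + 1) ≤ bracketingNumber H ρ :=
      le_iInf₂ fun U hU => Order.add_one_le_of_lt (hcon U hU)
    rw [hB] at this
    exact absurd this (not_le.2 (by exact_mod_cast Nat.lt_succ_self B))
  have hfin : U.Finite := Set.finite_of_encard_le_coe hcard
  refine ⟨hfin.toFinset.filter fun u => ∃ h : Hypothesis ν, Brackets h ρ u, ?_, ?_, ?_⟩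
  · refine (Finset.card_filter_le _ _).trans ?_
    rw [hfin.encard_eq_coe_toFinset_card] at hcard
    exact_mod_cast hcard
  · intro u hu
    exact (Finset.mem_filter.1 hu).2
  · intro h hh
    obtain ⟨u, hu, hle, hw⟩ := hU.2 h hh
    have hb : Brackets h ρ u := ⟨hU.1 u hu, hle, hw⟩
    exact ⟨u, Finset.mem_filter.2 ⟨hfin.mem_toFinset.2 hu, h, hb⟩, hb⟩

theorem regret_le_two_mul {S A : Type*} [MeasurableSpace S] [MeasurableSpace A] (M : AMDP S A)
    {J : ℝ} (hJ : J ≤ 1) (T : ℕ) (s : ℕ → S) (a : ℕ → A) : regret M J T s a ≤ 2 * T := by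
  refine (Finset.sum_le_card_nsmul _ _ 2 fun t _ => ?_).trans (le_of_eq ?_)
  · linarith [(M.r_mem (s t) (a t)).1]
  · rw [Nat.card_Icc, Nat.add_sub_cancel, nsmul_eq_mul, mul_comm]

/-- The burn-in term `sp² min(κ, T)` is dominated by `√(κ T β)` as soon as the claimed bound
improves on the trivial bound `2 T` on the regret. -/
theorem burn_in_le {sp d κ β T q C : ℝ} (hsp : 0 ≤ sp) (hd : 1 ≤ d) (hκ : 1 ≤ κ)
    (hT : 1 ≤ T) (hq : 0 ≤ q) (hC : 2 ≤ C) (hβ : 1 ≤ β) (hβsp : sp ≤ β)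
    (hlt : C * (1 + q) * (sp * (d * √κ) * √(T * β)) < 2 * T) :
    sp ^ 2 * min κ T ≤ √κ * √(T * β) := by
  have hκ0 : 0 ≤ κ := by linarith
  have hT0 : 0 < T := by linarith
  have hβ0 : 0 ≤ β := by linarith
  have hsκ : 1 ≤ √κ := Real.one_le_sqrt.2 hκ
  have hsT : 1 ≤ √T := Real.one_le_sqrt.2 hT
  have hsβ : 1 ≤ √β := Real.one_le_sqrt.2 hβ
  have hmulκ := Real.mul_self_sqrt hκ0
  have hmulT := Real.mul_self_sqrt hT0.le
  have hmulβ := Real.mul_self_sqrt hβ0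
  rw [Real.sqrt_mul hT0.le] at *
  set k := √κ
  set r := √T
  set b := √β
  rcases le_total sp 1 with h1 | h1
  · have hmin : min κ T ≤ k * r := by
      rcases le_total k r with h | h
      · exact (min_le_left _ _).trans (by nlinarith)
      · exact (min_le_right _ _).trans (by nlinarith)
    have hkr : 0 ≤ k * r := by positivity
    calc sp ^ 2 * min κ T ≤ 1 * (k * r) :=
          mul_le_mul (by nlinarith) hmin (le_min hκ0 hT0.le) (by norm_num)
      _ ≤ k * (r * b) := by nlinarith
  · have hpos : 0 ≤ sp * (k * (r * b)) := by positivity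
    have hfac : 2 * (sp * (k * (r * b))) ≤ C * (1 + q) * (sp * (d * k) * (r * b)) := by
      have e : C * (1 + q) * (sp * (d * k) * (r * b)) =
          (C * (1 + q) * d) * (sp * (k * (r * b))) := by ring
      rw [e]
      refine mul_le_mul_of_nonneg_right ?_ hpos
      have h2 : C * 1 ≤ C * (1 + q) := mul_le_mul_of_nonneg_left (by linarith) (by linarith)
      have h3 : C * (1 + q) * 1 ≤ C * (1 + q) * d :=
        mul_le_mul_of_nonneg_left hd (by linarith)
      linarith
    have hrk : sp * k * b < r := by
      by_contra hcon
      push Not at hcon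
      have : r * r ≤ (sp * k * b) * r := mul_le_mul_of_nonneg_right hcon (by linarith)
      nlinarith
    calc sp ^ 2 * min κ T ≤ sp ^ 2 * κ :=
          mul_le_mul_of_nonneg_left (min_le_left _ _) (by positivity)
      _ = (sp * κ) * sp := by ring
      _ ≤ (sp * κ) * β := mul_le_mul_of_nonneg_left hβsp (by positivity)
      _ = k * b * (sp * k * b) := by rw [← hmulκ, ← hmulβ]; ring
      _ ≤ k * b * r := mul_le_mul_of_nonneg_left hrk.le (by positivity)
      _ = k * (r * b) := by ring

/-- The final estimate. With `R = √κ √(T β)`, the sum `X` of the discrepancies is at most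
`(5 q + C₁ + 2) R`; it enters once through the Bellman errors and twice through the switches, and
the remaining terms amount to `3 R`. -/
theorem regret_bound_of_decomposition {Reg E D X V sp d κ β T q C₁ : ℝ} (hC₁ : 0 < C₁)
    (hsp : 0 ≤ sp) (hd : 1 ≤ d) (hκ : 1 ≤ κ) (hT : 1 ≤ T) (hq : 0 ≤ q) (hβ : 1 ≤ β)
    (hβsp : sp ≤ β) (htriv : Reg ≤ 2 * T) (hReg : Reg ≤ E + D + sp * (V + 1))
    (hE : E ≤ d * sp * X) (hV : V ≤ 2 * X) (hD : D ≤ 2 * sp * √(T * β))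
    (hX : X ≤ q * √(κ * (25 * β) * T) + C₁ * sp ^ 2 * min κ T + 2 * T * (1 / √T) ^ 2) :
    Reg ≤ (24 + 3 * C₁) * (1 + q) * (sp * (d * √κ) * √(T * β)) := by
  by_contra hcon
  push Not at hcon
  have hburn := burn_in_le hsp hd hκ hT hq (by linarith) hβ hβsp (hcon.trans_le htriv)
  have hTβ : 1 ≤ T * β := by nlinarith
  have hr : 1 ≤ √(T * β) := Real.one_le_sqrt.2 hTβ
  have hk : 1 ≤ √κ := Real.one_le_sqrt.2 hκ
  have e1 : √(κ * (25 * β) * T) = 5 * (√κ * √(T * β)) := by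
    rw [show κ * (25 * β) * T = 5 ^ 2 * (κ * (T * β)) by ring, Real.sqrt_mul (by norm_num),
      Real.sqrt_sq (by norm_num), Real.sqrt_mul (by linarith)]
  have e2 : 2 * T * (1 / √T) ^ 2 = 2 := by
    rw [div_pow, Real.sq_sqrt (by linarith)]
    field_simp
  rw [e1, e2] at hX
  have hRk : √(T * β) ≤ √κ * √(T * β) := le_mul_of_one_le_left (by linarith) hk
  rw [show sp * (d * √κ) * √(T * β) = d * sp * (√κ * √(T * β)) by ring] at hcon
  set R := √κ * √(T * β)
  have hR : 1 ≤ R := hr.trans hRk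
  have hX' : X ≤ (5 * q + C₁ + 2) * R := by
    have := mul_le_mul_of_nonneg_left hburn hC₁.le
    nlinarith
  have hds : 0 ≤ d * sp := by positivity
  have hsd : sp ≤ d * sp := le_mul_of_one_le_left hsp hd
  have h1 : d * sp * X ≤ d * sp * ((5 * q + C₁ + 2) * R) := mul_le_mul_of_nonneg_left hX' hds
  have h2 : sp * (V + 1) ≤ d * sp * (2 * ((5 * q + C₁ + 2) * R) + R) := by
    refine (mul_le_mul_of_nonneg_left (?_ : V + 1 ≤ _) hsp).trans
      (mul_le_mul_of_nonneg_right hsd ?_)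
    · linarith
    · positivity
  have h3 : D ≤ d * sp * (2 * R) := by
    refine hD.trans ?_
    rw [show 2 * sp * √(T * β) = sp * (2 * √(T * β)) by ring]
    exact mul_le_mul hsd (by linarith) (by positivity) hds
  have h4 : d * sp * ((5 * q + C₁ + 2) * R) + d * sp * (2 * R) +
      d * sp * (2 * ((5 * q + C₁ + 2) * R) + R) ≤ (24 + 3 * C₁) * (1 + q) * (d * sp * R) := by
    have hdR : 0 ≤ d * sp * R := by positivity
    have h5 : 3 * (5 * q + C₁ + 2) + 3 ≤ (24 + 3 * C₁) * (1 + q) := by nlinarith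
    have := mul_le_mul_of_nonneg_right h5 hdR
    nlinarith
  linarith

end AvgReward

open AvgReward
theorem mainTheorem4 :
    ∃ c : ℝ, 0 < c ∧ ∀ C₁ : ℝ, 0 < C₁ → ∃ C : ℝ, 0 < C ∧
      ∀ (S : Type*) [MeasurableSpace S] [StandardBorelSpace S]
        (A : Type*) [MeasurableSpace A] [MeasurableSingletonClass A] [Fintype A] [Nonempty A]
        (ν : Kernel (S × A) S) [IsSFiniteKernel ν]
        (M : AMDP S A) (Qstar : S → A → ℝ) (Jstar : ℝ)
        (_ : BellmanOptimality M.r (fun s a => M.P (s, a)) Qstar Jstar)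
        (H : Set (Hypothesis ν)) (fstar : Hypothesis ν)
        (_ : fstar.IsTrueModel M Qstar Jstar) (_ : fstar ∈ H)
        (_ : ∀ f ∈ H, spanOf f.V ≤ spanOf (greedyValue Qstar))
        (p : Polynomial ℝ) (_ : ∀ x : ℝ, 0 ≤ x → 0 ≤ p.eval x)
        (T : ℕ) (_ : 1 ≤ T) (δ : ℝ) (_ : 0 < δ) (_ : δ < 1)
        (dG κG : ℝ)
        (_ : IsMLEAGEC M H fstar (spanOf (greedyValue Qstar)) T C₁ p (1 / √(T : ℝ)) dG κG)
        (B : ℕ) (_ : bracketingNumber H (1 / (T : ℝ)) = (B : ℕ∞))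
        (β : ℝ) (_ : β = optimisticParameter c (spanOf (greedyValue Qstar)) T B δ)
        (s₁ : S) (Ω : Type*) [mΩ : MeasurableSpace Ω] (μ : Measure Ω) [IsProbabilityMeasure μ]
        (ℱ : Filtration ℕ mΩ) (s : ℕ → Ω → S) (a : ℕ → Ω → A) (f g : ℕ → Ω → Hypothesis ν)
        (_ : IsMLELoopProcess M H β T s₁ μ ℱ s a f g),
        ENNReal.ofReal (1 - 4 * δ) ≤
          μ {ω | regret M Jstar T (fun t => s t ω) (fun t => a t ω) ≤
            C * (1 + p.eval (Real.log T)) *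
              (spanOf (greedyValue Qstar) * (dG * √κG) * √(T * β))} := by
  -- `c = 100` gives `√β ≥ 10` and `1 + β + 2 L ≤ (5 / 4)² β`, the margins used at a switch
  refine ⟨100, by norm_num, fun C₁ hC₁ => ⟨24 + 3 * C₁, by positivity, ?_⟩⟩
  intro S _ _ A _ _ _ _ ν _ M Qstar Jstar hbell H fstar hM hstar hspan p hp T hT δ hδ hδ1 dG κG
    hAGEC B hB β hβ s₁ Ω mΩ μ _ ℱ s a f g hP
  -- for `δ ≥ 1/4` there is nothing to prove; otherwise `log (T B / δ) ≥ 1`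
  rcases le_or_gt (1 / 4) δ with hδ4 | hδ4
  · rw [ENNReal.ofReal_of_nonpos (by linarith)]
    exact zero_le
  have hT0 : (0 : ℝ) < T := by exact_mod_cast hT
  have hT1 : (1 : ℝ) ≤ T := by exact_mod_cast hT
  obtain ⟨U, hUB, hUbr, hUH⟩ := exists_finset_brackets hB
  have hB1 : (1 : ℝ) ≤ B := by
    obtain ⟨u, hu, -⟩ := hUH fstar hstar
    exact_mod_cast (Finset.card_pos.2 ⟨u, hu⟩).trans_le hUB
  obtain ⟨hd1, hdom⟩ := hAGEC.least_d.1
  obtain ⟨hκ1, htrans⟩ := hAGEC.least_κ.1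
  have hJ : fstar.J = Jstar := hM.J_eq
  have hJ1 : Jstar ≤ 1 := hbell.J_mem.2
  set sp := spanOf (greedyValue Qstar)
  have hsp : 0 ≤ sp := spanOf_nonneg _
  have hV : ∀ h ∈ H, ∀ x y, h.V x - h.V y ≤ sp := fun h hh x y => by
    obtain ⟨K, hK⟩ := h.exists_abs_V_le
    exact (le_abs_self _).trans ((abs_sub_le_spanOf hK x y).trans (hspan h hh))
  set L := Real.log (T * B / δ) with hLdef
  have hTB1 : (1 : ℝ) ≤ T * B := one_le_mul_of_one_le_of_one_le hT1 hB1
  have hTB : 4 ≤ T * B / δ := by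
    rw [le_div_iff₀ hδ]
    linarith
  have hexpL : Real.exp L = T * B / δ := Real.exp_log (by linarith)
  have hL : 1 ≤ L := by
    rw [hLdef, Real.le_log_iff_exp_le (by linarith)]
    linarith [Real.exp_one_lt_d9]
  have hβ' : β = 100 * max sp 1 * L := hβ
  have hβL : 100 * L ≤ β := by
    rw [hβ']
    have := le_max_right sp 1
    nlinarith
  have hβsp : sp ≤ β := by
    rw [hβ']
    have h1 := le_max_left sp 1
    have h2 := le_max_right sp 1
    nlinarith
  have hβ100 : 100 ≤ β := by linarith
  have hβ0 : 0 < β := by linarith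
  have hbad1 := hP.measure_ratio_le hM (ρ := 1 / (T : ℝ)) (by positivity) U hUbr
    (Real.exp_pos L)
  have hbad2 := hP.measure_martingale_gt_le hsp hspan hT (by linarith : 0 < L)
  have hδ1' : ENNReal.ofReal (U.card * T / Real.exp L) ≤ ENNReal.ofReal δ := by
    refine ENNReal.ofReal_le_ofReal ?_
    have : (U.card : ℝ) ≤ B := by exact_mod_cast hUB
    rw [hexpL, div_div_eq_mul_div, div_le_iff₀ (by positivity)]
    nlinarith [mul_le_mul_of_nonneg_left this (mul_pos hT0 hδ).le]
  have hδ2' : ENNReal.ofReal (Real.exp (-L)) ≤ ENNReal.ofReal δ := by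
    refine ENNReal.ofReal_le_ofReal ?_
    rw [Real.exp_neg, hexpL, inv_div, div_le_iff₀ (by positivity)]
    nlinarith
  replace hbad1 := hbad1.trans hδ1'
  replace hbad2 := hbad2.trans hδ2'
  set bad₁ := {ω | ∃ u ∈ U, ∃ n < T, Real.exp L ≤
    ∏ t ∈ Finset.Icc 1 n, ratioFactor fstar u (s t ω) (a t ω) (s (t + 1) ω)}
  set bad₂ := {ω | 2 * sp * (√L * √T) < ∑ t ∈ Finset.Icc 1 T,
    (∫ y, (f t ω).V y ∂(M.P (s t ω, a t ω)) - (f t ω).V (s (t + 1) ω))}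
  set good := {ω | regret M Jstar T (fun t => s t ω) (fun t => a t ω) ≤
    (24 + 3 * C₁) * (1 + p.eval (Real.log T)) * (sp * (dG * √κG) * √(T * β))}
  have hcover : ∀ᵐ ω ∂μ, ω ∈ good ∪ (bad₁ ∪ bad₂) := by
    filter_upwards [hP.path, hP.ae_dens_pos hM] with ω hpath hpos
    by_contra hω
    simp only [Set.mem_union, not_or] at hω
    obtain ⟨hng, hn1, hn2⟩ := hω
    refine hng ?_
    have hc : LikelihoodControl H fstar β T (fun t => s t ω) (fun t => a t ω) := by
      refine likelihoodControl_of_ratio hstar hT hpos hL hβL fun h hh => ?_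
      obtain ⟨u, hu, hb⟩ := hUH h hh
      exact ⟨u, hb, fun n hn => not_le.1 fun hcon => hn1 ⟨u, hu, n, hn, hcon⟩⟩
    have hreg := hpath.regret_le (M := M) hc hβ100 hsp hT hV
    rw [hJ] at hreg
    have habs : ∀ t i, |expDiscrepancy M fstar (f t ω) (s i ω) (a i ω)| =
        expDiscrepancy M fstar (f t ω) (s i ω) (a i ω) := fun t i =>
      abs_of_nonneg (expDiscrepancy_nonneg _ _ _ _ _)
    have hX := htrans (25 * β) (by linarith) (fun t => f t ω) (fun t => s t ω) (fun t => a t ω)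
      hpath.mem fun t ht => by
        have h1 := hpath.sum_tvDist_le hc hβ100 ht
        have h2 : √(25 * β * t) = 5 * √(β * t) := by
          rw [show 25 * β * (t : ℝ) = 5 ^ 2 * (β * t) by ring, Real.sqrt_mul (by norm_num),
            Real.sqrt_sq (by norm_num)]
        rw [h2]
        refine le_trans (Finset.sum_le_sum fun i _ => ?_) h1
        rw [habs]
        exact expDiscrepancy_le_tvDist hM _ _ _
    have hE := hdom (fun t => f t ω) (fun t => s t ω) (fun t => a t ω) hpath.mem
    have hTV : ∑ t ∈ Finset.Icc 1 T, tvDist (f t ω) fstar (s t ω) (a t ω) ≤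
        2 * ∑ t ∈ Finset.Icc 1 T, |expDiscrepancy M fstar (f t ω) (s t ω) (a t ω)| := by
      rw [Finset.mul_sum]
      refine Finset.sum_le_sum fun t _ => ?_
      rw [habs]
      exact tvDist_le_two_mul_expDiscrepancy hM _ _ _
    have hD : ∑ t ∈ Finset.Icc 1 T,
        (∫ y, (f t ω).V y ∂(M.P (s t ω, a t ω)) - (f t ω).V (s (t + 1) ω)) ≤
        2 * sp * √(T * β) := by
      refine (not_lt.1 hn2).trans (mul_le_mul_of_nonneg_left ?_ (by linarith))
      rw [Real.sqrt_mul hT0.le, mul_comm]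
      exact mul_le_mul_of_nonneg_left (Real.sqrt_le_sqrt (by linarith)) (Real.sqrt_nonneg _)
    exact regret_bound_of_decomposition hC₁ hsp hd1 hκ1 hT1 (hp _ (Real.log_nonneg hT1))
      (by linarith) hβsp (regret_le_two_mul M hJ1 T _ _) hreg hE hTV hD hX
  have h1 : (1 : ℝ≥0∞) ≤ μ good + (ENNReal.ofReal δ + ENNReal.ofReal δ) := by
    rw [← measure_univ (μ := μ)]
    calc μ Set.univ ≤ μ (good ∪ (bad₁ ∪ bad₂)) := measure_mono_ae (by
          filter_upwards [hcover] with ω hω _ using hω)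
      _ ≤ μ good + (μ bad₁ + μ bad₂) :=
          (measure_union_le _ _).trans (add_le_add_right (measure_union_le _ _) _)
      _ ≤ _ := add_le_add_right (add_le_add hbad1 hbad2) _
  rw [← ENNReal.ofReal_add hδ.le hδ.le] at h1
  refine le_trans ?_ (tsub_le_iff_right.2 h1)
  rw [← ENNReal.ofReal_one, ← ENNReal.ofReal_sub _ (by linarith)]
  exact ENNReal.ofReal_le_ofReal (by linarith)
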